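/- Let $m\ge 2$ and, for $i=1,\dots,m$, let $E_i$ be a metric space. Let $\big((X^1(\cdot),T^1),\dots,(X^m(\cdot),T^m)\big)$ be a random vector with an arbitrary joint law, where $X^i=(X^i(s))_{s\ge 0}$ is an $E_i$-valued process with almost surely right-continuous paths and $T^i$ is an almost surely nonnegative random variable that is nonarithmetic (for no $d>0$ is it almost surely a multiple of $d$) and has a finite and positive mean $\mu_i=ET^i$. (A random element of $E_i$ is understood to be Borel measurable with values in a separable subset of $E_i$; the latter is automatic when $E_i$ is separable.) Let $\big((X^1_n(\cdot),T^1_n),\dots,(X^m_n(\cdot),T^m_n)\big)$, $n\ge 1$, be i.i.d. random vectors with the same law as this one, also with almost surely right-continuous paths, all defined on one probability space. For each $i$ put $S^i_0=0$, $S^i_n=\sum_{k=1}^nT^i_k$, $N^i(t)=\sup\{n : S^i_n\le t\}$ and $$X_i(t)=X^i_{N^i(t)+1}\big(t-S^i_{N^i(t)}\big),\qquad t\ge 0 .$$ Assume that $\mu_1\le\dots\le\mu_m$, and let $v_1,\dots,v_m:[0,\infty)\to[0,\infty)$ be Borel functions such that $v_m(t)\to\infty$ as $t\to\infty$ and $$\liminf_{t\to\infty}\frac{v_i(t)}{v_{i+1}(t)}>\frac{\mu_i}{\mu_{i+1}},\qquad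 1\le i<m .$$ Then $\big(X_1(v_1(t)),\dots,X_m(v_m(t))\big)$ converges jointly in distribution, as $t\to\infty$, to a random vector $\big(X_1(\infty),\dots,X_m(\infty)\big)$ of $E_1\times\dots\times E_m$ with independent components, where for each $i$ and each nonnegative Borel function $g$ on $E_i$ $$E\,g(X_i(\infty))=\frac1{ET^i}\,E\int_0^{T^i}g(X^i(s))\,ds .$$ -/

import Mathlib

open MeasureTheory ProbabilityTheory Filter Topology
open scoped NNReal ENNReal

universe u

namespace RegenProduct

/-- The law of the real random variable `T` is nonarithmetic: for no `d > 0` is it concentrated on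
the multiples of `d`. -/
def Nonarithmetic {Ω : Type*} [MeasurableSpace Ω] (T : Ω → ℝ) (P : Measure Ω) : Prop :=
  ∀ d : ℝ, 0 < d → ¬ ∀ᵐ ω ∂P, ∃ k : ℤ, T ω = k * d

/-- The sum of the first `n` cycle lengths. The cycles are numbered `0, 1, 2, …`. -/
def renewalEpoch {Ω : Type*} (T : ℕ → Ω → ℝ) (n : ℕ) (ω : Ω) : ℝ :=
  ∑ k ∈ Finset.range n, T k ω

/-- `sup {n | S_n ≤ t}`. The set contains `0`; under the assumptions made on the cycle lengths it is
almost surely bounded. -/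
noncomputable def renewalCount {Ω : Type*} (T : ℕ → Ω → ℝ) (t : ℝ≥0) (ω : Ω) : ℕ :=
  sSup {n : ℕ | renewalEpoch T n ω ≤ t}

/-- The regenerative process built from the cycles `X 0, X 1, …` and the cycle lengths
`T 0, T 1, …`. The cycle in progress after `N(t)` renewals is the one with number `N(t)`, since the
numbering starts at `0`. -/
noncomputable def regenProcess {Ω E : Type*} (X : ℕ → Ω → ℝ≥0 → E) (T : ℕ → Ω → ℝ)
    (t : ℝ≥0) (ω : Ω) : E :=
  X (renewalCount T t ω) ω (t - renewalEpoch T (renewalCount T t ω) ω).toNNReal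

/-- Convergence in distribution of random elements of a topological space `S`, with respect to the
Borel σ-algebra of `S`. (For a product of nonseparable metric spaces the latter may be larger than
the product of the Borel σ-algebras of the factors.) -/
def ConvergesInDistribution {ι Ω Ω' S : Type*} [MeasurableSpace Ω] [MeasurableSpace Ω']
    [TopologicalSpace S] (Y : ι → Ω → S) (l : Filter ι) (Z : Ω' → S)
    (P : Measure Ω) [IsProbabilityMeasure P] (P' : Measure Ω') [IsProbabilityMeasure P'] : Prop :=
  letI : MeasurableSpace S := borel S
  haveI : BorelSpace S := ⟨rfl⟩
  TendstoInDistribution (fun i : ι => Y i) l Z (fun _ : ι => P) P'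

end RegenProduct

/-!
The state of one regenerative process at time `t` is in `A` with probability `∫ h (t - s) U(ds)`,
where `U` is the renewal measure of the law `F` of the cycle lengths and `h s` is the probability
that a cycle is still running at time `s` and is then in `A` (`occupation`). Everything rests on a
form of the renewal theorem that covers these functions `h`, and on a conditional version of this
formula.

*Renewal theorem.* Let `Z` be a bounded uniformly continuous solution of the renewal equation
`Z t = φ t + ∫ Z (t - y) F(dy)` with a forcing term `φ` that vanishes at infinity, and let `V t` be
the mean square of `Z (t - y) - Z t` under `F(dy)` (`stepVariance`). Up to terms that vanish at
infinity, `Z ^ 2 + V` is the average of `Z ^ 2` over shifts with law `F`, and `V` is at most its own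
average. By induction on `k` the upper limit of `Z ^ 2 + k * V` is at most `C ^ 2`, where `C` bounds
`|Z|`; so `V` tends to zero. Hence `Z (t - x) - Z t` tends to zero for the points `x` of the support
of `F`. The shifts with this property form a closed subgroup of `ℝ`, and this is all of `ℝ` as `F`
is nonarithmetic. The integrated renewal equation says that the integral of
`Z (t - a) * F (a, ∞)` over `a ≥ 0` is `∫ φ` for large `t`, and now `Z (t - a)` may be replaced by
`Z t` there, so `Z` converges to `∫ φ` divided by the mean (`tendsto_of_renewalEquation`).

*One process.* If `A` is open, right-continuity of the paths makes `h` lower semicontinuous from the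
right, hence lower semicontinuous off a countable set. Such an `h` is almost everywhere the limit of
Lipschitz minorants (`infConv`), which gives the lower bound `le_liminf_potential`. This bound,
applied to the interiors of a continuity set of the limit law and of its complement, yields the
limit (`tendsto_potential_occupation`).

*Joint law.* Given the first `k` cycles, the component `i` is in `A` at a time `v` after the end
`S_k` of these cycles with probability `∫ h (v - S_k - s) U(ds)` (`setLIntegral_regenProcess`). By
the law of large numbers the component `i` has used about `v_i t / μ_i` cycles, and by hypothesis
these numbers exceed each other by factors that stay above `1`. So there is a `k t` such that the
components `j > i` use only the first `k t` cycles while the time between the end of these cycles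
and `v_i t` tends to infinity for the component `i`: its conditional probabilities converge to a
constant, and it is asymptotically independent of the later components
(`tendsto_measureReal_inter`). The boxes of continuity sets are a π-system large enough for weak
convergence.

*General state spaces.* All paths stay, outside a null set, in closed separable subsets of the state
spaces. A measurable change of the outcomes in a null set removes the exceptional paths, and the
result for separable spaces is carried over by the inclusion map.
-/

namespace RegenProduct

/-! ### The renewal equation: vanishing of the step variance -/

section RenewalEquation

variable {F : Measure ℝ} [IsProbabilityMeasure F]

theorem integrable_of_continuous_of_bound {g : ℝ → ℝ}
    (hg : Continuous g) {C : ℝ} (hC : ∀ t, |g t| ≤ C) : Integrable g F :=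
  Integrable.of_bound hg.aestronglyMeasurable C (ae_of_all _ hC)

theorem tendsto_integral_shift {g : ℝ → ℝ} (hg : Continuous g) {C : ℝ} (hC : ∀ t, |g t| ≤ C)
    (h0 : Tendsto g atTop (𝓝 0)) : Tendsto (fun t => ∫ y, g (t - y) ∂F) atTop (𝓝 0) := by
  have := tendsto_integral_filter_of_dominated_convergence (μ := F) (l := (atTop : Filter ℝ))
    (F := fun t y => g (t - y)) (f := fun _ => 0) (fun _ => C)
    (Eventually.of_forall fun t => (hg.comp (by fun_prop)).aestronglyMeasurable)
    (Eventually.of_forall fun t => ae_of_all _ fun y => hC _) (integrable_const _)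
    (ae_of_all _ fun y => h0.comp (tendsto_atTop_add_const_right _ (-y) tendsto_id))
  simpa using this

/-- An upper bound for the upper limit at infinity survives averaging over shifts. -/
theorem tendsto_max_sub_integral_shift {g : ℝ → ℝ} (hg : Continuous g) {C : ℝ}
    (hC : ∀ t, |g t| ≤ C) {B : ℝ} (h0 : Tendsto (fun t => max (g t - B) 0) atTop (𝓝 0)) :
    Tendsto (fun t => max ((∫ y, g (t - y) ∂F) - B) 0) atTop (𝓝 0) := by
  have hb : ∀ t, |max (g t - B) 0| ≤ C + |B| := fun t => by
    have h1 := hC t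
    have h2 := le_abs_self (g t)
    have h3 := neg_abs_le B
    have h4 := abs_nonneg (g t)
    have h5 := abs_nonneg B
    rw [abs_of_nonneg (le_max_right _ _)]
    exact max_le (by linarith) (by linarith)
  have hc : Continuous fun t => max (g t - B) 0 := by fun_prop
  refine squeeze_zero (fun t => le_max_right _ _) (fun t => ?_)
    (tendsto_integral_shift (F := F) hc hb h0)
  refine max_le ?_ (integral_nonneg fun y => le_max_right _ _)
  have : (∫ y, g (t - y) ∂F) ≤ ∫ y, (max (g (t - y) - B) 0 + B) ∂F := by
    refine integral_mono ?_ ?_ fun y => ?_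
    · exact integrable_of_continuous_of_bound (hg.comp (by fun_prop)) fun y => hC _
    · exact (integrable_of_continuous_of_bound (hc.comp (by fun_prop)) fun y => hb _).add
        (integrable_const _)
    · have := le_max_left (g (t - y) - B) 0
      linarith
  have hi : Integrable (fun y => max (g (t - y) - B) 0) F :=
    integrable_of_continuous_of_bound (hc.comp (by fun_prop)) fun y => hb _
  rw [integral_add hi (integrable_const _)] at this
  simp at this
  linarith

/-- The mean square increment `E (Z (t - T) - Z t) ^ 2` of `Z` over a step with law `F`. -/
noncomputable def stepVariance (F : Measure ℝ) (Z : ℝ → ℝ) (t : ℝ) : ℝ :=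
  ∫ y, (Z (t - y) - Z t) ^ 2 ∂F

section

variable {Z φ : ℝ → ℝ} {C : ℝ}

theorem abs_sq_increment_le (hC : ∀ t, |Z t| ≤ C) (s t : ℝ) :
    |(Z s - Z t) ^ 2| ≤ (2 * C) ^ 2 := by
  rw [abs_pow]
  have := abs_sub (Z s) (Z t)
  have h1 := hC s
  have h2 := hC t
  gcongr
  linarith

theorem continuous_stepVariance (hZ : Continuous Z) (hC : ∀ t, |Z t| ≤ C) :
    Continuous (stepVariance F Z) := by
  refine continuous_of_dominated (bound := fun _ => (2 * C) ^ 2) (fun t => ?_) (fun t => ?_)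
    (integrable_const _) ?_
  · exact (Continuous.aestronglyMeasurable (by fun_prop))
  · exact ae_of_all _ fun y => abs_sq_increment_le hC _ _
  · exact ae_of_all _ fun y => by fun_prop

theorem stepVariance_nonneg {F : Measure ℝ} {Z : ℝ → ℝ} (t : ℝ) : 0 ≤ stepVariance F Z t :=
  integral_nonneg fun _ => sq_nonneg _

theorem abs_stepVariance_le (hC : ∀ t, |Z t| ≤ C) (t : ℝ) :
    |stepVariance F Z t| ≤ (2 * C) ^ 2 := by
  have := norm_integral_le_of_norm_le_const (μ := F) (f := fun y => (Z (t - y) - Z t) ^ 2)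
    (C := (2 * C) ^ 2) (ae_of_all _ fun y => abs_sq_increment_le hC _ _)
  simpa [stepVariance] using this

theorem sq_add_stepVariance (hZ : Continuous Z) (hC : ∀ t, |Z t| ≤ C)
    (hren : ∀ t, Z t = φ t + ∫ y, Z (t - y) ∂F) (t : ℝ) :
    Z t ^ 2 + stepVariance F Z t = (∫ y, Z (t - y) ^ 2 ∂F) + 2 * Z t * φ t := by
  have i1 : Integrable (fun y => Z (t - y)) F :=
    integrable_of_continuous_of_bound (hZ.comp (by fun_prop)) fun y => hC _
  have i2 : Integrable (fun y => Z (t - y) ^ 2) F :=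
    integrable_of_continuous_of_bound (C := C ^ 2) ((hZ.comp (by fun_prop)).pow 2) fun y => by
      rw [abs_pow]; gcongr; exact hC _
  have : stepVariance F Z t
      = ∫ y, ((Z (t - y) ^ 2 - 2 * Z t * Z (t - y)) + Z t ^ 2) ∂F := by
    unfold stepVariance; congr 1; ext y; ring
  have i3 : Integrable (fun y => 2 * Z t * Z (t - y)) F := i1.const_mul _
  have i4 : Integrable (fun y => Z (t - y) ^ 2 - 2 * Z t * Z (t - y)) F := i2.sub i3
  rw [this, integral_add i4 (integrable_const _), integral_sub i2 i3, integral_const_mul]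
  have h := hren t
  have : ∫ y, Z (t - y) ∂F = Z t - φ t := by linarith
  rw [this]
  simp
  ring

/-- Jensen's inequality: up to the forcing term, the increment of `Z` over a step `y` is the mean of
the increments over the same step `y` after an independent step `y'`. -/
theorem stepVariance_le (hZ : Continuous Z) (hφ : Continuous φ) (hC : ∀ t, |Z t| ≤ C)
    (hCφ : ∀ t, |φ t| ≤ C) (hren : ∀ t, Z t = φ t + ∫ y, Z (t - y) ∂F) (t : ℝ) :
    stepVariance F Z t ≤ (∫ y, stepVariance F Z (t - y) ∂F)
      + 4 * C * ((∫ y, |φ (t - y)| ∂F) + |φ t|) := by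
  have hC0 : 0 ≤ C := (abs_nonneg _).trans (hC 0)
  set J : ℝ → ℝ := fun y => ∫ y', (Z (t - y' - y) - Z (t - y')) ^ 2 ∂F with hJ
  have hprod : Integrable (Function.uncurry fun y y' : ℝ => (Z (t - y' - y) - Z (t - y')) ^ 2)
      (F.prod F) := by
    refine Integrable.of_bound (Continuous.aestronglyMeasurable ?_) ((2 * C) ^ 2)
      (ae_of_all _ fun p => abs_sq_increment_le hC _ _)
    simp only [Function.uncurry_def]
    fun_prop
  have hswap : ∫ y, J y ∂F = ∫ y, stepVariance F Z (t - y) ∂F :=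
    integral_integral_swap hprod
  have hJi : Integrable J F := hprod.integral_prod_left
  have hφi : Integrable (fun y => |φ (t - y)|) F :=
    integrable_of_continuous_of_bound (C := C) ((hφ.comp (by fun_prop)).abs) fun y => by
      rw [abs_abs]; exact hCφ _
  have key : ∀ y, (Z (t - y) - Z t) ^ 2 ≤ J y + 4 * C * (|φ (t - y)| + |φ t|) := by
    intro y
    set D := ∫ y', (Z (t - y' - y) - Z (t - y')) ∂F with hD
    have iA : Integrable (fun y' => Z (t - y' - y)) F :=
      integrable_of_continuous_of_bound (hZ.comp (by fun_prop)) fun y => hC _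
    have iB : Integrable (fun y' => Z (t - y')) F :=
      integrable_of_continuous_of_bound (hZ.comp (by fun_prop)) fun y => hC _
    have hDJ : D ^ 2 ≤ J y := by
      have i2 : Integrable (fun y' => (Z (t - y' - y) - Z (t - y')) ^ 2) F :=
        integrable_of_continuous_of_bound (by fun_prop) fun _ => abs_sq_increment_le hC _ _
      have : 0 ≤ ∫ y', (Z (t - y' - y) - Z (t - y') - D) ^ 2 ∂F :=
        integral_nonneg fun _ => sq_nonneg _
      have e : ∫ y', (Z (t - y' - y) - Z (t - y') - D) ^ 2 ∂F = J y - D ^ 2 := by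
        have : ∀ y', (Z (t - y' - y) - Z (t - y') - D) ^ 2
          = ((Z (t - y' - y) - Z (t - y')) ^ 2 - 2 * D * (Z (t - y' - y) - Z (t - y')))
            + D ^ 2 := fun y' => by ring
        simp_rw [this]
        have i1 : Integrable (fun y' => 2 * D * (Z (t - y' - y) - Z (t - y'))) F :=
          (iA.sub iB).const_mul (2 * D)
        have i3 : Integrable (fun y' => (Z (t - y' - y) - Z (t - y')) ^ 2
          - 2 * D * (Z (t - y' - y) - Z (t - y'))) F := i2.sub i1
        rw [integral_add i3 (integrable_const _), integral_sub i2 i1, integral_const_mul, ← hD]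
        simp
        ring
      linarith
    have hd : Z (t - y) - Z t = (φ (t - y) - φ t) + D := by
      rw [hD, integral_sub iA iB, hren (t - y), hren t]
      simp_rw [sub_right_comm t y]
      ring
    have hDb : |D| ≤ 2 * C := by
      have := norm_integral_le_of_norm_le_const (μ := F)
        (f := fun y' => Z (t - y' - y) - Z (t - y')) (C := 2 * C) (ae_of_all _ fun y' => by
          have := abs_sub (Z (t - y' - y)) (Z (t - y'))
          have h1 := hC (t - y' - y)
          have h2 := hC (t - y')
          rw [Real.norm_eq_abs]
          linarith)
      simpa using this
    have hzb : |Z (t - y) - Z t| ≤ 2 * C := by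
      have := abs_sub (Z (t - y)) (Z t)
      have h1 := hC (t - y)
      have h2 := hC t
      linarith
    have : (Z (t - y) - Z t) ^ 2 - D ^ 2 ≤ 4 * C * (|φ (t - y)| + |φ t|) := by
      calc (Z (t - y) - Z t) ^ 2 - D ^ 2
          = (φ (t - y) - φ t) * ((Z (t - y) - Z t) + D) := by rw [hd]; ring
        _ ≤ |(φ (t - y) - φ t) * ((Z (t - y) - Z t) + D)| := le_abs_self _
        _ = |φ (t - y) - φ t| * |(Z (t - y) - Z t) + D| := abs_mul _ _
        _ ≤ (|φ (t - y)| + |φ t|) * (4 * C) := by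
            gcongr
            · exact abs_sub _ _
            · have := abs_add_le (Z (t - y) - Z t) D
              linarith
        _ = _ := by ring
    linarith
  have i3 : Integrable (fun y => 4 * C * (|φ (t - y)| + |φ t|)) F :=
    (hφi.add (integrable_const _)).const_mul _
  calc stepVariance F Z t ≤ ∫ y, (J y + 4 * C * (|φ (t - y)| + |φ t|)) ∂F := by
        refine integral_mono ?_ (hJi.add i3) key
        exact integrable_of_continuous_of_bound (by fun_prop) fun _ => abs_sq_increment_le hC _ _
    _ = _ := by
        rw [integral_add hJi i3, hswap, integral_const_mul,
          integral_add hφi (integrable_const _)]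
        simp

/-- Every step raises the upper limit of `Z ^ 2 + k * stepVariance` at infinity by one more copy of
the step variance, so that upper limit is at most `C ^ 2` for all `k`. -/
theorem tendsto_max_sq_add_mul_stepVariance (hZ : Continuous Z) (hφ : Continuous φ)
    (hC : ∀ t, |Z t| ≤ C) (hCφ : ∀ t, |φ t| ≤ C) (hφ0 : Tendsto φ atTop (𝓝 0))
    (hren : ∀ t, Z t = φ t + ∫ y, Z (t - y) ∂F) (k : ℕ) :
    Tendsto (fun t => max (Z t ^ 2 + k * stepVariance F Z t - C ^ 2) 0) atTop (𝓝 0) := by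
  have hC0 : 0 ≤ C := (abs_nonneg _).trans (hC 0)
  have hsq : ∀ t, Z t ^ 2 ≤ C ^ 2 := fun t => sq_le_sq.2 (by rw [abs_of_nonneg hC0]; exact hC t)
  induction k with
  | zero =>
    refine Tendsto.congr (fun t => (max_eq_right ?_).symm) tendsto_const_nhds
    have := hsq t
    simp only [Nat.cast_zero, zero_mul, add_zero]
    linarith
  | succ k ih =>
    have hVc := continuous_stepVariance (F := F) hZ hC
    set g : ℝ → ℝ := fun t => Z t ^ 2 + k * stepVariance F Z t with hg
    have hgc : Continuous g := by fun_prop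
    have hgb : ∀ t, |g t| ≤ C ^ 2 + k * (2 * C) ^ 2 := fun t => by
      refine (abs_add_le _ _).trans ?_
      rw [abs_mul, Nat.abs_cast, abs_of_nonneg (sq_nonneg (Z t))]
      have := abs_stepVariance_le (F := F) hC t
      have := hsq t
      gcongr
    have h1 := tendsto_max_sub_integral_shift (F := F) hgc hgb ih
    have habs : Tendsto (fun t => |φ t|) atTop (𝓝 0) := by simpa using hφ0.abs
    have h2 := tendsto_integral_shift (F := F) hφ.abs (C := C)
      (fun t => by rw [abs_abs]; exact hCφ t) habs
    have h3 : Tendsto (fun t => max ((∫ y, g (t - y) ∂F) - C ^ 2) 0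
        + (2 * C * |φ t| + k * (4 * C * ((∫ y, |φ (t - y)| ∂F) + |φ t|)))) atTop (𝓝 0) := by
      have := h1.add ((habs.const_mul (2 * C)).add
        (((h2.add habs).const_mul (4 * C)).const_mul (k : ℝ)))
      simpa using this
    refine squeeze_zero (fun t => le_max_right _ _) (fun t => max_le ?_ ?_) h3
    · have e1 := sq_add_stepVariance hZ hC hren t
      have e2 := mul_le_mul_of_nonneg_left (stepVariance_le hZ hφ hC hCφ hren t)
        (Nat.cast_nonneg (α := ℝ) k)
      have e3 : ∫ y, g (t - y) ∂F
          = (∫ y, Z (t - y) ^ 2 ∂F) + k * ∫ y, stepVariance F Z (t - y) ∂F := by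
        rw [← integral_const_mul, ← integral_add]
        · exact integrable_of_continuous_of_bound (C := C ^ 2) (by fun_prop) fun y => by
            rw [abs_of_nonneg (sq_nonneg _)]; exact hsq _
        · exact (integrable_of_continuous_of_bound (hVc.comp (by fun_prop))
            fun y => abs_stepVariance_le hC _).const_mul _
      have e4 : 2 * Z t * φ t ≤ 2 * C * |φ t| := by
        refine (le_abs_self _).trans ?_
        rw [abs_mul, abs_mul, abs_two]
        have := hC t
        gcongr
      have e5 := le_max_left ((∫ y, g (t - y) ∂F) - C ^ 2) 0
      push_cast
      linarith
    · have : 0 ≤ ∫ y, |φ (t - y)| ∂F := integral_nonneg fun _ => abs_nonneg _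
      have := le_max_right ((∫ y, g (t - y) ∂F) - C ^ 2) 0
      positivity

theorem tendsto_stepVariance (hZ : Continuous Z) (hφ : Continuous φ)
    (hC : ∀ t, |Z t| ≤ C) (hCφ : ∀ t, |φ t| ≤ C) (hφ0 : Tendsto φ atTop (𝓝 0))
    (hren : ∀ t, Z t = φ t + ∫ y, Z (t - y) ∂F) :
    Tendsto (stepVariance F Z) atTop (𝓝 0) := by
  refine tendsto_order.2 ⟨fun a ha => Eventually.of_forall fun t =>
    ha.trans_le (stepVariance_nonneg t), fun a ha => ?_⟩
  obtain ⟨k, hk⟩ := exists_nat_gt ((C ^ 2 + 1) / a)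
  have h := tendsto_max_sq_add_mul_stepVariance hZ hφ hC hCφ hφ0 hren k
  filter_upwards [(tendsto_order.1 h).2 1 one_pos] with t ht
  have h1 := (le_max_left _ _).trans_lt ht
  rw [div_lt_iff₀ ha] at hk
  have hk0 : (0 : ℝ) < k := by
    by_contra h0
    have : (k : ℝ) = 0 := le_antisymm (not_lt.1 h0) (Nat.cast_nonneg _)
    rw [this] at hk
    nlinarith [sq_nonneg C]
  have h2 := sq_nonneg (Z t)
  by_contra h3
  push Not at h3
  have := mul_le_mul_of_nonneg_left h3 hk0.le
  linarith

end

end RenewalEquation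

/-! ### The renewal equation: convergence of uniformly continuous solutions -/

section RenewalEquation

variable {F : Measure ℝ} [IsProbabilityMeasure F] {Z φ : ℝ → ℝ} {C : ℝ}

/-- Shifts by points of the support of `F` leave `Z` asymptotically unchanged. -/
theorem tendsto_shift_sub_of_mem_support (hZ : UniformContinuous Z) (hC : ∀ t, |Z t| ≤ C)
    (hV : Tendsto (stepVariance F Z) atTop (𝓝 0)) {x : ℝ} (hx : x ∈ F.support) :
    Tendsto (fun t => Z (t - x) - Z t) atTop (𝓝 0) := by
  rw [Metric.tendsto_nhds]
  intro ε hε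
  obtain ⟨δ, hδ, hδZ⟩ := Metric.uniformContinuous_iff.1 hZ (ε / 3) (by positivity)
  set p := F.real (Metric.ball x δ) with hp
  have hp0 : 0 < p := ENNReal.toReal_pos
    ((Measure.mem_support_iff_forall x).1 hx _ (Metric.ball_mem_nhds x hδ)).ne'
    (measure_ne_top _ _)
  filter_upwards [(tendsto_order.1 hV).2 (p * (ε / 3) ^ 2) (by positivity)] with t ht
  rw [Real.dist_eq, sub_zero]
  by_contra hcon
  push Not at hcon
  have h1 : ∫ y in Metric.ball x δ, (ε / 3) ^ 2 ∂F ≤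
      ∫ y in Metric.ball x δ, (Z (t - y) - Z t) ^ 2 ∂F := by
    have hi : Integrable (fun y => (Z (t - y) - Z t) ^ 2) F := by
      have := hZ.continuous
      exact integrable_of_continuous_of_bound (by fun_prop) fun _ => abs_sq_increment_le hC _ _
    refine setIntegral_mono_on (integrableOn_const (by finiteness)) hi.integrableOn
      measurableSet_ball fun y hy => ?_
    have h2 : |Z (t - y) - Z (t - x)| < ε / 3 := by
      rw [← Real.dist_eq]
      refine hδZ ?_
      rw [Real.dist_eq, show t - y - (t - x) = x - y by ring, ← Real.dist_eq, dist_comm]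
      exact hy
    rw [sq_le_sq, abs_of_pos (by positivity : 0 < ε / 3)]
    have h3 : |Z (t - x) - Z t| ≤ |Z (t - x) - Z (t - y)| + |Z (t - y) - Z t| := abs_sub_le _ _ _
    have h4 := abs_sub_comm (Z (t - x)) (Z (t - y))
    linarith
  have h2 : ∫ y in Metric.ball x δ, (Z (t - y) - Z t) ^ 2 ∂F ≤ stepVariance F Z t := by
    have hi : Integrable (fun y => (Z (t - y) - Z t) ^ 2) F := by
      have := hZ.continuous
      exact integrable_of_continuous_of_bound (by fun_prop) fun _ => abs_sq_increment_le hC _ _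
    exact setIntegral_le_integral hi (ae_of_all _ fun y => sq_nonneg _)
  rw [setIntegral_const, smul_eq_mul] at h1
  linarith

/-- The shifts that leave `Z` asymptotically unchanged. -/
def asymptoticPeriods (Z : ℝ → ℝ) : AddSubgroup ℝ where
  carrier := {a | Tendsto (fun t => Z (t - a) - Z t) atTop (𝓝 0)}
  zero_mem' := by simp
  add_mem' := by
    intro a b ha hb
    have h := (ha.comp (tendsto_atTop_add_const_right _ (-b) tendsto_id)).add hb
    simp only [add_zero] at h
    refine h.congr fun t => ?_
    simp only [Function.comp_apply, id]
    rw [show t - (a + b) = t + -b - a by ring, show t + -b = t - b by ring]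
    ring
  neg_mem' := by
    intro a ha
    have h := (ha.comp (tendsto_atTop_add_const_right _ a tendsto_id)).neg
    simp only [neg_zero] at h
    refine h.congr fun t => ?_
    simp only [Function.comp_apply, id]
    rw [show t + a - a = t by ring, show t - -a = t + a by ring]
    ring

theorem isClosed_asymptoticPeriods (hZ : UniformContinuous Z) :
    IsClosed (asymptoticPeriods Z : Set ℝ) := by
  refine isClosed_of_closure_subset fun a ha => ?_
  change Tendsto (fun t => Z (t - a) - Z t) atTop (𝓝 0)
  rw [Metric.tendsto_nhds]
  intro ε hε
  obtain ⟨δ, hδ, hδZ⟩ := Metric.uniformContinuous_iff.1 hZ (ε / 2) (by positivity)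
  obtain ⟨b, hb, hab⟩ := Metric.mem_closure_iff.1 ha δ hδ
  have hb' : Tendsto (fun t => Z (t - b) - Z t) atTop (𝓝 0) := hb
  filter_upwards [Metric.tendsto_nhds.1 hb' (ε / 2) (by positivity)] with t ht
  rw [Real.dist_eq, sub_zero] at ht ⊢
  have h2 : |Z (t - a) - Z (t - b)| < ε / 2 := by
    rw [← Real.dist_eq]
    refine hδZ ?_
    rw [Real.dist_eq, show t - a - (t - b) = b - a by ring, ← Real.dist_eq, dist_comm]
    exact hab
  have h3 : |Z (t - a) - Z t| ≤ |Z (t - a) - Z (t - b)| + |Z (t - b) - Z t| := abs_sub_le _ _ _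
  linarith

theorem asymptoticPeriods_eq_top (hF : Nonarithmetic id F) (hZ : UniformContinuous Z)
    (hC : ∀ t, |Z t| ≤ C) (hV : Tendsto (stepVariance F Z) atTop (𝓝 0)) :
    asymptoticPeriods Z = ⊤ := by
  have hsupp : ∀ᵐ y ∂F, y ∈ asymptoticPeriods Z := by
    filter_upwards [Measure.support_mem_ae (μ := F)] with y hy
    exact tendsto_shift_sub_of_mem_support hZ hC hV hy
  rcases (asymptoticPeriods Z).dense_or_cyclic with hd | ⟨a, ha⟩
  · refine SetLike.coe_injective ?_
    rw [← (isClosed_asymptoticPeriods hZ).closure_eq, hd.closure_eq]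
    rfl
  · exfalso
    rw [ha] at hsupp
    simp only [AddSubgroup.mem_closure_singleton, zsmul_eq_mul] at hsupp
    rcases lt_trichotomy a 0 with h | h | h
    · refine hF (-a) (by linarith) ?_
      filter_upwards [hsupp] with y ⟨k, hk⟩
      exact ⟨-k, by simp [← hk]⟩
    · refine hF 1 one_pos ?_
      filter_upwards [hsupp] with y ⟨k, hk⟩
      exact ⟨0, by simp [← hk, h]⟩
    · refine hF a h ?_
      filter_upwards [hsupp] with y ⟨k, hk⟩
      exact ⟨k, by simp [← hk]⟩

/-- The renewal equation integrated over `[0, t]`. -/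
theorem integral_mul_tail_eq (hF0 : ∀ᵐ y ∂F, 0 ≤ y) (hZ : Continuous Z) (hφ : Continuous φ)
    (hC : ∀ t, |Z t| ≤ C) (hZ0 : ∀ t < 0, Z t = 0)
    (hren : ∀ t, Z t = φ t + ∫ y, Z (t - y) ∂F) (t : ℝ) :
    ∫ a in Set.Ici 0, Z (t - a) * F.real (Set.Ioi a) = ∫ s in Set.Icc 0 t, φ s := by
  set ν : Measure ℝ := volume.restrict (Set.Icc 0 t) with hν
  have : IsFiniteMeasure ν := ⟨by simp [hν]⟩
  -- the indicator of the steps that do not lead from `s` beyond `t`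
  set I : ℝ → ℝ → ℝ := fun y s => (Set.Iic (t - s)).indicator (fun _ => Z s) y with hI
  have hImeas : Measurable (Function.uncurry I) := by
    have : Function.uncurry I = {p : ℝ × ℝ | p.1 ≤ t - p.2}.indicator fun p => Z p.2 := by
      ext p
      simp [hI, Function.uncurry_def, Set.indicator_apply]
    rw [this]
    refine Measurable.indicator (by fun_prop) (measurableSet_le (by fun_prop) (by fun_prop))
  have hIint : Integrable (Function.uncurry I) (F.prod ν) := by
    refine Integrable.of_bound hImeas.aestronglyMeasurable C (ae_of_all _ fun p => ?_)
    simp only [Function.uncurry_def, hI]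
    exact (norm_indicator_le_norm_self _ _).trans (hC _)
  have hZint : Integrable (Function.uncurry fun y s : ℝ => Z (s - y)) (F.prod ν) := by
    refine Integrable.of_bound (Continuous.aestronglyMeasurable ?_) C (ae_of_all _ fun p => hC _)
    simp only [Function.uncurry_def]
    fun_prop
  have e1 : ∫ s, (∫ y, Z (s - y) ∂F) ∂ν = ∫ y, (∫ s, Z (s - y) ∂ν) ∂F :=
    (integral_integral_swap hZint).symm
  have e2 : ∫ y, (∫ s, Z (s - y) ∂ν) ∂F = ∫ y, (∫ s, I y s ∂ν) ∂F := by
    refine integral_congr_ae ?_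
    filter_upwards [hF0] with y hy
    rw [hν, ← integral_indicator measurableSet_Icc, ← integral_indicator measurableSet_Icc,
      ← integral_add_right_eq_self (fun s => (Set.Icc 0 t).indicator (fun s => Z (s - y)) s) y]
    congr 1
    ext s
    by_cases hs : s < 0
    · simp [Set.indicator_apply, hI, hZ0 s hs]
    · push Not at hs
      simp only [Set.indicator_apply, hI, Set.mem_Icc, Set.mem_Iic, add_sub_cancel_right]
      by_cases h : s + y ≤ t
      · rw [if_pos ⟨by linarith, h⟩, if_pos ⟨hs, by linarith⟩, if_pos (by linarith)]
      · rw [if_neg (fun h' => h h'.2)]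
        by_cases h2 : s ≤ t
        · rw [if_pos ⟨hs, h2⟩, if_neg (by linarith)]
        · rw [if_neg (fun h' => h2 h'.2)]
  have e3 : ∫ y, (∫ s, I y s ∂ν) ∂F = ∫ s, Z s * F.real (Set.Iic (t - s)) ∂ν := by
    rw [integral_integral_swap hIint]
    congr 1
    ext s
    simp only [hI]
    rw [integral_indicator measurableSet_Iic, setIntegral_const, smul_eq_mul, mul_comm]
  have hφi : Integrable φ ν := (hφ.integrableOn_Icc)
  have hZi : Integrable Z ν := hZ.integrableOn_Icc
  have hqi : Integrable (fun s => ∫ y, Z (s - y) ∂F) ν := hZint.swap.integral_prod_left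
  have hTi : Integrable (fun s => Z s * F.real (Set.Iic (t - s))) ν := by
    have := hIint.swap.integral_prod_left
    refine this.congr (ae_of_all _ fun s => ?_)
    simp only [Function.comp_apply, Prod.swap_prod_mk, Function.uncurry_apply_pair, hI]
    rw [integral_indicator measurableSet_Iic, setIntegral_const, smul_eq_mul, mul_comm]
  have e4 : ∫ s, Z s ∂ν = ∫ s, φ s ∂ν + ∫ s, Z s * F.real (Set.Iic (t - s)) ∂ν := by
    rw [← e3, ← e2, ← e1, ← integral_add hφi hqi]
    exact integral_congr_ae (ae_of_all _ hren)
  have e5 : ∫ s, φ s ∂ν = ∫ s, Z s * F.real (Set.Ioi (t - s)) ∂ν := by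
    have : ∫ s, φ s ∂ν = ∫ s, Z s ∂ν - ∫ s, Z s * F.real (Set.Iic (t - s)) ∂ν := by linarith
    rw [this, ← integral_sub hZi hTi]
    congr 1
    ext s
    have := probReal_add_probReal_compl (μ := F) (s := Set.Iic (t - s)) measurableSet_Iic
    rw [Set.compl_Iic] at this
    linear_combination (-Z s) * this
  rw [e5, hν, ← integral_indicator measurableSet_Icc, ← integral_indicator measurableSet_Ici,
    ← integral_sub_left_eq_self _ volume t]
  congr 1
  ext a
  simp only [Set.indicator_apply, Set.mem_Ici, Set.mem_Icc, sub_sub_cancel]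
  by_cases h : a < 0
  · simp [hZ0 a h]
  · push Not at h
    simp [h]

theorem integrable_tail {F : Measure ℝ} (hF0 : ∀ᵐ y ∂F, 0 ≤ y) (hFi : Integrable id F)
    (hFpos : 0 < ∫ y, y ∂F) :
    IntegrableOn (fun a => F.real (Set.Ioi a)) (Set.Ici 0) ∧
      ∫ a in Set.Ici 0, F.real (Set.Ioi a) = ∫ y, y ∂F := by
  have h := hFi.integral_eq_integral_meas_lt hF0
  have e : ∫ a in Set.Ici 0, F.real (Set.Ioi a) = ∫ y, y ∂F := by
    rw [integral_Ici_eq_integral_Ioi]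
    exact h.symm
  refine ⟨?_, e⟩
  by_contra hn
  rw [integral_undef hn] at e
  linarith

/-- **The renewal theorem** for uniformly continuous solutions of the renewal equation. -/
theorem tendsto_of_renewalEquation (hF : Nonarithmetic id F) (hF0 : ∀ᵐ y ∂F, 0 ≤ y)
    (hFi : Integrable id F) (hFpos : 0 < ∫ y, y ∂F) (hZ : UniformContinuous Z)
    (hφ : Continuous φ) (hC : ∀ t, |Z t| ≤ C) (hCφ : ∀ t, |φ t| ≤ C)
    (hZ0 : ∀ t < 0, Z t = 0) (hφ0 : ∀ t < 0, φ t = 0) {b : ℝ} (hφb : ∀ t > b, φ t = 0)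
    (hren : ∀ t, Z t = φ t + ∫ y, Z (t - y) ∂F) :
    Tendsto Z atTop (𝓝 ((∫ s, φ s) / ∫ y, y ∂F)) := by
  have hφlim : Tendsto φ atTop (𝓝 0) :=
    tendsto_const_nhds.congr' ((eventually_gt_atTop b).mono fun t ht => (hφb t ht).symm)
  have hV := tendsto_stepVariance (F := F) hZ.continuous hφ hC hCφ hφlim hren
  have htop := asymptoticPeriods_eq_top hF hZ hC hV
  have hshift : ∀ a, Tendsto (fun t => Z (t - a) - Z t) atTop (𝓝 0) := fun a => by
    have : a ∈ asymptoticPeriods Z := htop ▸ AddSubgroup.mem_top a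
    exact this
  obtain ⟨hTi, hT⟩ := integrable_tail hF0 hFi hFpos
  have hbound : ∀ t a, |(Z (t - a) - Z t) * F.real (Set.Ioi a)| ≤ 2 * C * F.real (Set.Ioi a) := by
    intro t a
    rw [abs_mul, abs_of_nonneg (a := F.real (Set.Ioi a)) measureReal_nonneg]
    have h1 := abs_sub (Z (t - a)) (Z t)
    have h2 := hC (t - a)
    have h3 := hC t
    gcongr
    linarith
  have hFm : Measurable fun a => F.real (Set.Ioi a) :=
    (Antitone.measurable fun a b hab => measureReal_mono (Set.Ioi_subset_Ioi hab))
  have hZm := hZ.continuous.measurable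
  have hlim : Tendsto (fun t => ∫ a in Set.Ici 0, (Z (t - a) - Z t) * F.real (Set.Ioi a))
      atTop (𝓝 0) := by
    have := tendsto_integral_filter_of_dominated_convergence
      (μ := volume.restrict (Set.Ici (0 : ℝ))) (l := (atTop : Filter ℝ))
      (F := fun t a => (Z (t - a) - Z t) * F.real (Set.Ioi a)) (f := fun _ => 0)
      (fun a => 2 * C * F.real (Set.Ioi a))
      (Eventually.of_forall fun t => Measurable.aestronglyMeasurable (by fun_prop))
      (Eventually.of_forall fun t => ae_of_all _ fun a => hbound t a) (hTi.const_mul _)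
      (ae_of_all _ fun a => by simpa using (hshift a).mul_const (F.real (Set.Ioi a)))
    simpa using this
  have hφint : ∀ t ≥ b, ∫ s in Set.Icc 0 t, φ s = ∫ s, φ s := by
    intro t ht
    refine setIntegral_eq_integral_of_forall_compl_eq_zero fun s hs => ?_
    rw [Set.mem_Icc, not_and_or, not_le, not_le] at hs
    rcases hs with hs | hs
    · exact hφ0 s hs
    · exact hφb s (lt_of_le_of_lt ht hs)
  have hid : ∀ t ≥ b, Z t = ((∫ s, φ s)
      - ∫ a in Set.Ici 0, (Z (t - a) - Z t) * F.real (Set.Ioi a)) / ∫ y, y ∂F := by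
    intro t ht
    rw [eq_div_iff hFpos.ne', ← hT, ← hφint t ht,
      ← integral_mul_tail_eq hF0 hZ.continuous hφ hC hZ0 hren t]
    have hi : IntegrableOn (fun a => Z t * F.real (Set.Ioi a)) (Set.Ici 0) := hTi.const_mul _
    have hi2 : IntegrableOn (fun a => (Z (t - a) - Z t) * F.real (Set.Ioi a)) (Set.Ici 0) :=
      (hTi.const_mul (2 * C)).mono' (Measurable.aestronglyMeasurable (by fun_prop))
        (ae_of_all _ fun a => hbound t a)
    have e : ∫ a in Set.Ici 0, Z (t - a) * F.real (Set.Ioi a)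
        = ∫ a in Set.Ici 0, ((Z (t - a) - Z t) * F.real (Set.Ioi a)
          + Z t * F.real (Set.Ioi a)) := by
      congr 1; ext a; ring
    rw [e, integral_add hi2 hi, integral_const_mul]
    ring
  have h := (hlim.const_sub (∫ s, φ s)).div_const (∫ y, y ∂F)
  rw [sub_zero] at h
  exact h.congr' ((eventually_ge_atTop b).mono fun t ht => (hid t ht).symm)

end RenewalEquation

/-! ### The renewal measure -/

/-- The `n`-fold convolution power of `F`, the law of the sum of `n` independent variables with
law `F`. -/
noncomputable def convPow (F : Measure ℝ) : ℕ → Measure ℝ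
  | 0 => Measure.dirac 0
  | n + 1 => F.conv (convPow F n)

/-- The renewal measure of `F`: the expected number of renewals in a set. The renewal at time `0`
is counted. -/
noncomputable def renewalMeasure (F : Measure ℝ) : Measure ℝ :=
  Measure.sum (convPow F)

/-- The potential `∫ g (t - s) U(ds)` of `g` with respect to the renewal measure `U`, the solution
`Z` of the renewal equation `Z = g + Z * F`. -/
noncomputable def potential (F : Measure ℝ) (g : ℝ → ℝ≥0∞) (t : ℝ) : ℝ≥0∞ :=
  ∫⁻ s, g (t - s) ∂(renewalMeasure F)

/-- The tail `F (a, ∞)` as a function of `a`, set to zero for negative `a`. -/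
noncomputable def tailFun (F : Measure ℝ) (a : ℝ) : ℝ≥0∞ :=
  (Set.Ici 0).indicator (fun a => F (Set.Ioi a)) a

section RenewalMeasure

variable {F : Measure ℝ} [IsProbabilityMeasure F] {g : ℝ → ℝ≥0∞}

instance isProbabilityMeasure_convPow (n : ℕ) : IsProbabilityMeasure (convPow F n) := by
  induction n with
  | zero => exact inferInstanceAs (IsProbabilityMeasure (Measure.dirac 0))
  | succ n ih => exact inferInstanceAs (IsProbabilityMeasure (F.conv (convPow F n)))

instance sFinite_renewalMeasure : SFinite (renewalMeasure F) :=
  inferInstanceAs (SFinite (Measure.sum (convPow F)))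

theorem potential_eq_tsum {F : Measure ℝ} (g : ℝ → ℝ≥0∞) (t : ℝ) :
    potential F g t = ∑' n, ∫⁻ s, g (t - s) ∂(convPow F n) := by
  rw [potential, renewalMeasure, lintegral_sum_measure]

theorem measurable_potential (hg : Measurable g) : Measurable (potential F g) := by
  unfold potential
  exact Measurable.lintegral_prod_right' (f := fun p : ℝ × ℝ => g (p.1 - p.2)) (by fun_prop)

theorem potential_mono {F : Measure ℝ} {g g' : ℝ → ℝ≥0∞} (h : ∀ s, g s ≤ g' s) (t : ℝ) :
    potential F g t ≤ potential F g' t :=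
  lintegral_mono fun _ => h _

theorem lintegral_convPow_succ (n : ℕ) (hg : Measurable g) :
    ∫⁻ s, g s ∂(convPow F (n + 1)) = ∫⁻ y, ∫⁻ s, g (y + s) ∂(convPow F n) ∂F :=
  Measure.lintegral_conv hg

theorem potential_renewalEquation (hg : Measurable g) (t : ℝ) :
    potential F g t = g t + ∫⁻ y, potential F g (t - y) ∂F := by
  have h1 : ∀ n, ∫⁻ s, g (t - s) ∂(convPow F (n + 1))
      = ∫⁻ y, ∫⁻ s, g (t - y - s) ∂(convPow F n) ∂F := fun n => by
    rw [lintegral_convPow_succ n (by fun_prop)]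
    simp_rw [sub_sub]
  simp_rw [potential_eq_tsum]
  rw [tsum_eq_zero_add' ENNReal.summable, lintegral_tsum]
  · congr 1
    · change ∫⁻ s, g (t - s) ∂(Measure.dirac 0) = g t
      rw [lintegral_dirac' _ (by fun_prop), sub_zero]
    · exact tsum_congr h1
  · intro n
    refine Measurable.aemeasurable ?_
    exact Measurable.lintegral_prod_right' (f := fun p : ℝ × ℝ => g (t - p.1 - p.2)) (by fun_prop)

theorem ae_nonneg_convPow {F : Measure ℝ} [SFinite F] (hF0 : ∀ᵐ y ∂F, 0 ≤ y) (n : ℕ) :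
    ∀ᵐ s ∂(convPow F n), 0 ≤ s := by
  induction n with
  | zero =>
    change ∀ᵐ s ∂(Measure.dirac 0), (0 : ℝ) ≤ s
    rw [ae_dirac_iff measurableSet_Ici]
  | succ n ih =>
    change ∀ᵐ s ∂((F.prod (convPow F n)).map (fun x : ℝ × ℝ ↦ x.1 + x.2)), 0 ≤ s
    rw [ae_map_iff (by fun_prop) measurableSet_Ici]
    have h1 : ∀ᵐ p ∂(F.prod (convPow F n)), 0 ≤ p.1 :=
      Measure.quasiMeasurePreserving_fst.ae hF0
    have h2 : ∀ᵐ p ∂(F.prod (convPow F n)), 0 ≤ p.2 :=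
      Measure.quasiMeasurePreserving_snd.ae ih
    filter_upwards [h1, h2] with p hp1 hp2
    exact add_nonneg hp1 hp2

theorem ae_nonneg_renewalMeasure (hF0 : ∀ᵐ y ∂F, 0 ≤ y) : ∀ᵐ s ∂(renewalMeasure F), 0 ≤ s :=
  Measure.ae_sum_iff.2 (ae_nonneg_convPow hF0)

theorem measurable_tailFun {F : Measure ℝ} : Measurable (tailFun F) :=
  Measurable.indicator (Antitone.measurable fun _ _ h => measure_mono (Set.Ioi_subset_Ioi h))
    measurableSet_Ici

theorem lintegral_tailFun_add (hF0 : ∀ᵐ y ∂F, 0 ≤ y) (n : ℕ) (t : ℝ) :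
    ∫⁻ s, tailFun F (t - s) ∂(convPow F n) + convPow F (n + 1) (Set.Iic t)
      = convPow F n (Set.Iic t) := by
  have h1 : convPow F (n + 1) (Set.Iic t) = ∫⁻ s, F (Set.Iic (t - s)) ∂(convPow F n) := by
    rw [← lintegral_indicator_one measurableSet_Iic]
    have : convPow F (n + 1) = (convPow F n).conv F := Measure.conv_comm _ _
    rw [this, Measure.lintegral_conv (measurable_one.indicator measurableSet_Iic)]
    congr 1
    ext s
    rw [← lintegral_indicator_one measurableSet_Iic]
    congr 1
    ext y
    simp only [Set.indicator_apply, Set.mem_Iic, le_sub_iff_add_le, add_comm, Pi.one_apply]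
  have hm : Measurable fun s => tailFun F (t - s) := measurable_tailFun.comp (by fun_prop)
  rw [h1, ← lintegral_add_left hm,
    ← lintegral_indicator_one measurableSet_Iic]
  congr 1
  ext s
  by_cases hs : s ≤ t
  · have h0 : (0 : ℝ) ≤ t - s := by linarith
    simp only [tailFun, Set.indicator_apply, Set.mem_Ici, h0, if_true, Set.mem_Iic, hs,
      Pi.one_apply]
    rw [← Set.compl_Iic, add_comm, prob_add_prob_compl measurableSet_Iic]
  · have h0 : ¬ (0 : ℝ) ≤ t - s := by linarith
    simp only [tailFun, Set.indicator_apply, Set.mem_Ici, h0, if_false, Set.mem_Iic, hs, zero_add]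
    refine measure_mono_null (fun y hy => ?_) hF0
    simp only [Set.mem_compl_iff, Set.mem_ofPred_eq, not_le]
    have := Set.mem_Iic.1 hy
    linarith

/-- The events that renewal `n` happens by time `t` and renewal `n + 1` after time `t`, for `n < N`,
partition the event that renewal `N` happens after time `t ≥ 0`. -/
theorem sum_lintegral_tailFun_add (hF0 : ∀ᵐ y ∂F, 0 ≤ y) (N : ℕ) (t : ℝ) :
    ∑ n ∈ Finset.range N, ∫⁻ s, tailFun F (t - s) ∂(convPow F n) + convPow F N (Set.Iic t)
      = convPow F 0 (Set.Iic t) := by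
  induction N with
  | zero => simp
  | succ N ih => rw [Finset.sum_range_succ, add_assoc, lintegral_tailFun_add hF0, ih]

theorem potential_tailFun_le_one (hF0 : ∀ᵐ y ∂F, 0 ≤ y) (t : ℝ) :
    potential F (tailFun F) t ≤ 1 := by
  rw [potential_eq_tsum, ENNReal.tsum_eq_iSup_nat]
  refine iSup_le fun N => ?_
  calc _ ≤ _ := le_self_add
    _ = convPow F 0 (Set.Iic t) := sum_lintegral_tailFun_add hF0 N t
    _ ≤ 1 := prob_le_one

theorem exists_tail_pos {F : Measure ℝ} (hFpos : 0 < ∫ y, y ∂F) : ∃ η > 0, 0 < F (Set.Ioi η) := by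
  by_contra! h
  have h0 : F (Set.Ioi 0) = 0 := by
    have : Set.Ioi (0 : ℝ) = ⋃ n : ℕ, Set.Ioi (1 / ((n : ℝ) + 1)) := by
      ext x
      simp only [Set.mem_Ioi, Set.mem_iUnion]
      exact ⟨fun hx => exists_nat_one_div_lt hx, fun ⟨n, hn⟩ => lt_trans (by positivity) hn⟩
    rw [this]
    exact measure_iUnion_null fun n => le_antisymm (h _ (by positivity)) bot_le
  have : ∫ y, y ∂F ≤ 0 := integral_nonpos_of_ae (by
    filter_upwards [measure_eq_zero_iff_ae_notMem.1 h0] with y hy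
    simpa using hy)
  linarith

/-- The renewal measure is bounded on the intervals of any given length, uniformly in their
position. -/
theorem exists_renewalMeasure_Icc_le (hF0 : ∀ᵐ y ∂F, 0 ≤ y) (hFpos : 0 < ∫ y, y ∂F) (b : ℝ) :
    ∃ C : ℝ≥0, ∀ t, renewalMeasure F (Set.Icc (t - b) t) ≤ C := by
  obtain ⟨η, hη, hp⟩ := exists_tail_pos hFpos
  set K : ℝ≥0∞ := (F (Set.Ioi η))⁻¹ with hK
  have hKtop : K ≠ ⊤ := ENNReal.inv_ne_top.2 hp.ne'
  have h1 : ∀ t, renewalMeasure F (Set.Icc (t - η) t) ≤ K := by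
    intro t
    rw [hK, ENNReal.le_inv_iff_mul_le]
    calc renewalMeasure F (Set.Icc (t - η) t) * F (Set.Ioi η)
        = ∫⁻ _ in Set.Icc (t - η) t, F (Set.Ioi η) ∂(renewalMeasure F) := by
          rw [setLIntegral_const, mul_comm]
      _ ≤ ∫⁻ s in Set.Icc (t - η) t, tailFun F (t - s) ∂(renewalMeasure F) := by
          refine setLIntegral_mono (measurable_tailFun.comp (by fun_prop)) fun s hs => ?_
          have h0 : t - s ∈ Set.Ici (0 : ℝ) := by simpa using hs.2
          rw [tailFun, Set.indicator_of_mem h0]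
          exact measure_mono (Set.Ioi_subset_Ioi (by linarith [hs.1]))
      _ ≤ potential F (tailFun F) t := setLIntegral_le_lintegral _ _
      _ ≤ 1 := potential_tailFun_le_one hF0 t
  have h2 : ∀ k : ℕ, ∀ t, renewalMeasure F (Set.Icc (t - k * η) t) ≤ (k + 1) * K := by
    intro k
    induction k with
    | zero =>
      intro t
      simp only [Nat.cast_zero, zero_mul, zero_add, one_mul]
      exact (measure_mono (Set.Icc_subset_Icc (by linarith) le_rfl)).trans (h1 t)
    | succ k ih =>
      intro t
      have hsub : Set.Icc (t - ((k + 1 : ℕ) : ℝ) * η) t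
          ⊆ Set.Icc (t - η - k * η) (t - η) ∪ Set.Icc (t - η) t := by
        intro s hs
        push_cast at hs
        rcases le_total s (t - η) with h | h
        · exact Or.inl ⟨by linarith [hs.1], h⟩
        · exact Or.inr ⟨h, hs.2⟩
      refine (measure_mono hsub).trans ((measure_union_le _ _).trans ?_)
      push_cast
      rw [add_mul _ (1 : ℝ≥0∞) K, one_mul]
      exact add_le_add (ih _) (h1 t)
  obtain ⟨k, hk⟩ := exists_nat_ge (b / η)
  rw [div_le_iff₀ hη] at hk
  have htop : ((k : ℝ≥0∞) + 1) * K ≠ ⊤ := by finiteness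
  refine ⟨(((k : ℝ≥0∞) + 1) * K).toNNReal, fun t => ?_⟩
  rw [ENNReal.coe_toNNReal htop]
  exact (measure_mono (Set.Icc_subset_Icc (by linarith) le_rfl)).trans (h2 k t)

theorem potential_tailFun_eq_one (hF0 : ∀ᵐ y ∂F, 0 ≤ y) (hFpos : 0 < ∫ y, y ∂F) {t : ℝ}
    (ht : 0 ≤ t) : potential F (tailFun F) t = 1 := by
  obtain ⟨C, hC⟩ := exists_renewalMeasure_Icc_le hF0 hFpos t
  have hsum : ∑' n, convPow F n (Set.Iic t) ≠ ⊤ := by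
    have : ∑' n, convPow F n (Set.Iic t) = renewalMeasure F (Set.Icc (t - t) t) := by
      rw [renewalMeasure, Measure.sum_apply _ measurableSet_Icc]
      refine tsum_congr fun n => measure_congr ?_
      filter_upwards [ae_nonneg_convPow hF0 n] with s hs
      refine propext ⟨fun h => ⟨by simpa using hs, h⟩, fun h => h.2⟩
    rw [this]
    exact ((hC t).trans_lt ENNReal.coe_lt_top).ne
  have h1 : Tendsto (fun N => ∑ n ∈ Finset.range N, ∫⁻ s, tailFun F (t - s) ∂(convPow F n)
      + convPow F N (Set.Iic t)) atTop (𝓝 (potential F (tailFun F) t + 0)) := by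
    rw [potential_eq_tsum]
    exact ENNReal.summable.hasSum.tendsto_sum_nat.add
      (ENNReal.tendsto_atTop_zero_of_tsum_ne_top hsum)
  simp_rw [sum_lintegral_tailFun_add hF0, add_zero] at h1
  rw [tendsto_nhds_unique h1 tendsto_const_nhds]
  change Measure.dirac 0 (Set.Iic t) = 1
  simp [ht]

/-- **The renewal theorem** for the potentials of Lipschitz functions with bounded support. -/
theorem tendsto_potential_of_lipschitz (hF : Nonarithmetic id F) (hF0 : ∀ᵐ y ∂F, 0 ≤ y)
    (hFi : Integrable id F) (hFpos : 0 < ∫ y, y ∂F) {φ : ℝ → ℝ} {L : ℝ≥0} {b : ℝ}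
    (hL : LipschitzWith L φ) (hφ0 : ∀ t, 0 ≤ φ t) (hφneg : ∀ t < 0, φ t = 0)
    (hφb : ∀ t > b, φ t = 0) :
    Tendsto (potential F fun s => ENNReal.ofReal (φ s)) atTop
      (𝓝 (ENNReal.ofReal ((∫ s, φ s) / ∫ y, y ∂F))) := by
  set U := renewalMeasure F with hU
  obtain ⟨K, hK⟩ := exists_renewalMeasure_Icc_le hF0 hFpos b
  have hKr : ∀ t, U.real (Set.Icc (t - b) t) ≤ K := fun t =>
    ENNReal.toReal_le_of_le_ofReal K.2 (by simpa using hK t)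
  have hUfin : ∀ t, U (Set.Icc (t - b) t) ≠ ⊤ := fun t => ((hK t).trans_lt ENNReal.coe_lt_top).ne
  have hφc := hL.continuous
  obtain ⟨M, hM0, hM⟩ : ∃ M, 0 ≤ M ∧ ∀ t, φ t ≤ M := by
    have hcs : HasCompactSupport φ := HasCompactSupport.intro (K := Set.Icc 0 b) isCompact_Icc
      fun x hx => by
        rw [Set.mem_Icc, not_and_or, not_le, not_le] at hx
        exact hx.elim (hφneg x) (hφb x)
    obtain ⟨M, hM⟩ := hφc.bounded_above_of_compact_support hcs
    exact ⟨M, (norm_nonneg _).trans (hM 0), fun t => (le_abs_self _).trans (hM t)⟩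
  have hsupp : ∀ t s, s ∉ Set.Icc (t - b) t → φ (t - s) = 0 := by
    intro t s hs
    rw [Set.mem_Icc, not_and_or, not_le, not_le] at hs
    rcases hs with h | h
    · exact hφb _ (by linarith)
    · exact hφneg _ (by linarith)
  have hφi : ∀ t, Integrable (fun s => φ (t - s)) U := by
    intro t
    refine (integrableOn_iff_integrable_of_support_subset (s := Set.Icc (t - b) t) fun s hs => ?_).1
      (Measure.integrableOn_of_bounded (M := M) (hUfin t)
        (hφc.comp (by fun_prop)).aestronglyMeasurable (ae_of_all _ fun s => ?_))
    · by_contra h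
      exact hs (hsupp t s h)
    · rw [Real.norm_eq_abs, abs_of_nonneg (hφ0 _)]
      exact hM _
  set Z : ℝ → ℝ := fun t => ∫ s, φ (t - s) ∂U with hZdef
  have hZ0 : ∀ t, 0 ≤ Z t := fun t => integral_nonneg fun s => hφ0 _
  have hZpot : ∀ t, ENNReal.ofReal (Z t) = potential F (fun s => ENNReal.ofReal (φ s)) t :=
    fun t => ofReal_integral_eq_lintegral_ofReal (hφi t) (ae_of_all _ fun s => hφ0 _)
  have hZb : ∀ t, |Z t| ≤ M * K := by
    intro t
    rw [abs_of_nonneg (hZ0 t)]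
    calc Z t = ∫ s in Set.Icc (t - b) t, φ (t - s) ∂U :=
          (setIntegral_eq_integral_of_forall_compl_eq_zero (hsupp t)).symm
      _ ≤ ‖∫ s in Set.Icc (t - b) t, φ (t - s) ∂U‖ := Real.le_norm_self _
      _ ≤ M * U.real (Set.Icc (t - b) t) := norm_setIntegral_le_of_norm_le_const
          (hUfin t).lt_top fun s _ => by
            rw [Real.norm_eq_abs, abs_of_nonneg (hφ0 _)]
            exact hM _
      _ ≤ M * K := by gcongr; exact hKr t
  have hZL : LipschitzWith (L * (K + K)) Z := by
    refine LipschitzWith.of_dist_le_mul fun t t' => ?_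
    set S := Set.Icc (t - b) t ∪ Set.Icc (t' - b) t' with hS
    have hStop : U S < ⊤ := (measure_union_le _ _).trans_lt
      (ENNReal.add_lt_top.2 ⟨(hUfin t).lt_top, (hUfin t').lt_top⟩)
    have hSK : U.real S ≤ K + K := (measureReal_union_le _ _).trans (add_le_add (hKr t) (hKr t'))
    have e : Z t - Z t' = ∫ s in S, (φ (t - s) - φ (t' - s)) ∂U := by
      rw [setIntegral_eq_integral_of_forall_compl_eq_zero, integral_sub (hφi t) (hφi t')]
      intro s hs
      rw [hS, Set.mem_union, not_or] at hs
      rw [hsupp t s hs.1, hsupp t' s hs.2, sub_zero]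
    rw [dist_eq_norm, e]
    calc _ ≤ (L * dist t t') * U.real S := norm_setIntegral_le_of_norm_le_const hStop fun s _ => by
            rw [← dist_eq_norm]
            refine (hL.dist_le_mul _ _).trans_eq ?_
            simp
      _ ≤ (L * dist t t') * (K + K) := by gcongr
      _ = _ := by push_cast; ring
  have hZneg : ∀ t < 0, Z t = 0 := by
    intro t ht
    refine integral_eq_zero_of_ae ?_
    filter_upwards [ae_nonneg_renewalMeasure hF0] with s hs
    exact hφneg _ (by linarith)
  have hφb' : ∀ t, |φ t| ≤ M := fun t => by rw [abs_of_nonneg (hφ0 _)]; exact hM _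
  have hren : ∀ t, Z t = φ t + ∫ y, Z (t - y) ∂F := by
    intro t
    have h := potential_renewalEquation (F := F) (g := fun s => ENNReal.ofReal (φ s))
      (by fun_prop) t
    simp_rw [← hZpot] at h
    rw [← ofReal_integral_eq_lintegral_ofReal, ← ENNReal.ofReal_add (hφ0 t)] at h
    · rwa [ENNReal.ofReal_eq_ofReal_iff (hZ0 t)] at h
      exact add_nonneg (hφ0 t) (integral_nonneg fun y => hZ0 _)
    · exact integral_nonneg fun y => hZ0 _
    · exact integrable_of_continuous_of_bound (hZL.continuous.comp (by fun_prop)) fun y => hZb _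
    · exact ae_of_all _ fun y => hZ0 _
  have hmain := tendsto_of_renewalEquation hF hF0 hFi hFpos hZL.uniformContinuous hφc
    (C := max (M * K) M) (fun t => (hZb t).trans (le_max_left _ _))
    (fun t => (hφb' t).trans (le_max_right _ _)) hZneg hφneg hφb hren
  exact (ENNReal.tendsto_ofReal hmain).congr hZpot

end RenewalMeasure

/-! ### Forcing functions that are lower semicontinuous from the right -/

section LowerSemicontinuity

/-- A function that is lower semicontinuous from the right everywhere is lower semicontinuous off a
countable set. -/
theorem ae_lowerSemicontinuousAt_of_right {h : ℝ → ℝ≥0∞}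
    (hr : ∀ x, ∀ c < h x, ∀ᶠ y in 𝓝[>] x, c < h y) :
    ∀ᵐ x : ℝ, ∀ c < h x, ∀ᶠ y in 𝓝 x, c < h y := by
  -- the points at which lower semicontinuity fails by jumping over the level `q`
  set B : ℚ → Set ℝ := fun q =>
    {x | ENNReal.ofReal q < h x ∧ ¬ ∀ᶠ y in 𝓝 x, ENNReal.ofReal q < h y} with hB
  have hBc : ∀ q, (B q).Countable := by
    intro q
    refine Set.Countable.mono (fun x hx => ?_)
      (countable_setOfPred_isolated_right_within (s := B q))
    refine ⟨hx, ?_⟩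
    obtain ⟨u, hu, hxu⟩ := mem_nhdsGT_iff_exists_Ioo_subset.1 (hr x _ hx.1)
    rw [← empty_mem_iff_bot, mem_nhdsWithin]
    refine ⟨Set.Iio u, isOpen_Iio, hu, ?_⟩
    rintro y ⟨hyu, hyB, hxy⟩
    exact hyB.2 (Filter.mem_of_superset (Ioo_mem_nhds hxy hyu) hxu)
  have hBn : (volume : Measure ℝ) (⋃ q, B q) = 0 := (Set.countable_iUnion hBc).measure_zero _
  filter_upwards [measure_eq_zero_iff_ae_notMem.1 hBn] with x hx c hc
  obtain ⟨q, hq0, hcq, hqh⟩ := ENNReal.lt_iff_exists_rat_btwn.1 hc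
  by_contra hcon
  refine hx (Set.mem_iUnion.2 ⟨q, hqh, fun hev => hcon ?_⟩)
  filter_upwards [hev] with y hy
  exact hcq.trans hy

/-- The infimal convolution of `h` with `n * |·|`. For `h ≥ 0` it is an `n`-Lipschitz minorant
of `h`. -/
noncomputable def infConv (h : ℝ → ℝ) (n : ℝ≥0) (x : ℝ) : ℝ :=
  ⨅ y, (h y + n * |x - y|)

variable {h : ℝ → ℝ}

theorem bddBelow_infConv (hh : ∀ y, 0 ≤ h y) (n : ℝ≥0) (x : ℝ) :
    BddBelow (Set.range fun y => h y + n * |x - y|) :=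
  ⟨0, by rintro _ ⟨y, rfl⟩; exact add_nonneg (hh y) (by positivity)⟩

theorem infConv_nonneg (hh : ∀ y, 0 ≤ h y) (n : ℝ≥0) (x : ℝ) : 0 ≤ infConv h n x :=
  le_ciInf fun y => add_nonneg (hh y) (by positivity)

theorem infConv_le (hh : ∀ y, 0 ≤ h y) (n : ℝ≥0) (x : ℝ) : infConv h n x ≤ h x :=
  (ciInf_le (bddBelow_infConv hh n x) x).trans_eq (by simp)

theorem lipschitzWith_infConv (hh : ∀ y, 0 ≤ h y) (n : ℝ≥0) : LipschitzWith n (infConv h n) := by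
  refine LipschitzWith.of_le_add_mul n fun x x' => ?_
  rw [← sub_le_iff_le_add]
  refine le_ciInf fun y => ?_
  rw [sub_le_iff_le_add]
  refine (ciInf_le (bddBelow_infConv hh n x) y).trans ?_
  have h1 : |x - y| ≤ |x - x'| + |x' - y| := abs_sub_le _ _ _
  have h2 := mul_le_mul_of_nonneg_left h1 n.2
  rw [Real.dist_eq]
  change (n : ℝ) * _ ≤ n * _ at h2
  rw [mul_add] at h2
  linarith

end LowerSemicontinuity

section RenewalTheorem

variable {F : Measure ℝ} [IsProbabilityMeasure F]

/-- **The renewal theorem** as a lower bound, for forcing functions that are lower semicontinuous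
from the right. -/
theorem le_liminf_potential (hF : Nonarithmetic id F) (hF0 : ∀ᵐ y ∂F, 0 ≤ y)
    (hFi : Integrable id F) (hFpos : 0 < ∫ y, y ∂F) {h : ℝ → ℝ≥0∞}
    (h1 : ∀ s, h s ≤ 1) (hneg : ∀ s < 0, h s = 0)
    (hr : ∀ x, ∀ c < h x, ∀ᶠ y in 𝓝[>] x, c < h y) :
    (∫⁻ s, h s) / ENNReal.ofReal (∫ y, y ∂F) ≤ liminf (potential F h) atTop := by
  set k : ℕ → ℝ → ℝ := fun n => (Set.Iio (n : ℝ)).indicator fun y => (h y).toReal with hk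
  set φ : ℕ → ℝ → ℝ := fun n => infConv (k n) n with hφ
  have htop : ∀ s, h s ≠ ⊤ := fun s => ((h1 s).trans_lt ENNReal.one_lt_top).ne
  have hk0 : ∀ n y, 0 ≤ k n y := fun n y =>
    Set.indicator_nonneg (fun y _ => ENNReal.toReal_nonneg) y
  have hφ0 : ∀ n s, 0 ≤ φ n s := fun n s => infConv_nonneg (hk0 n) _ s
  have hφk : ∀ n s, φ n s ≤ k n s := fun n s => infConv_le (hk0 n) _ s
  have hφh : ∀ n s, ENNReal.ofReal (φ n s) ≤ h s := by
    intro n s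
    refine ENNReal.ofReal_le_of_le_toReal ((hφk n s).trans ?_)
    exact Set.indicator_le_self' (fun _ _ => ENNReal.toReal_nonneg) s
  have hφneg : ∀ n, ∀ s < 0, φ n s = 0 := fun n s hs =>
    le_antisymm ((hφk n s).trans (by simp [hk, Set.indicator_apply, hneg s hs])) (hφ0 n s)
  have hφb : ∀ n : ℕ, ∀ s > (n : ℝ), φ n s = 0 := fun n s hs =>
    le_antisymm ((hφk n s).trans (by simp [hk, not_lt.2 hs.le])) (hφ0 n s)
  have hφL : ∀ n : ℕ, LipschitzWith n (φ n) := fun n => lipschitzWith_infConv (hk0 n) n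
  have hbound : ∀ n, ∫⁻ s, ENNReal.ofReal (φ n s)
      ≤ liminf (potential F h) atTop * ENNReal.ofReal (∫ y, y ∂F) := by
    intro n
    have hlim := tendsto_potential_of_lipschitz hF hF0 hFi hFpos (hφL n) (hφ0 n) (hφneg n) (hφb n)
    have hi : Integrable (φ n) := by
      refine (hφL n).continuous.integrable_of_hasCompactSupport
        (HasCompactSupport.intro (K := Set.Icc 0 (n : ℝ)) isCompact_Icc fun x hx => ?_)
      rw [Set.mem_Icc, not_and_or, not_le, not_le] at hx
      exact hx.elim (hφneg n x) (hφb n x)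
    rw [← ofReal_integral_eq_lintegral_ofReal hi (ae_of_all _ (hφ0 n))]
    rw [ENNReal.ofReal_div_of_pos hFpos] at hlim
    rw [← ENNReal.div_le_iff (by simpa using hFpos) ENNReal.ofReal_ne_top, ← hlim.liminf_eq]
    exact liminf_le_liminf (Eventually.of_forall fun t => potential_mono (hφh n) t)
  have hconv : ∀ᵐ x : ℝ, h x ≤ liminf (fun n => ENNReal.ofReal (φ n x)) atTop := by
    filter_upwards [ae_lowerSemicontinuousAt_of_right hr] with x hx
    refine le_of_forall_lt fun c hc => ?_
    obtain ⟨c', hcc', hc'⟩ := exists_between hc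
    refine hcc'.trans_le (le_liminf_of_le (by isBoundedDefault) ?_)
    have hc'top : c' ≠ ⊤ := hc'.ne_top
    obtain ⟨δ, hδ, hball⟩ := Metric.eventually_nhds_iff_ball.1 (hx c' hc')
    obtain ⟨N, hN⟩ := exists_nat_ge (max (x + δ) (1 / δ))
    filter_upwards [eventually_ge_atTop N] with n hn
    have hNn : (N : ℝ) ≤ n := by exact_mod_cast hn
    have hn1 : x + δ ≤ n := (le_max_left _ _).trans (hN.trans hNn)
    have hn2 : 1 / δ ≤ n := (le_max_right _ _).trans (hN.trans hNn)
    rw [ENNReal.le_ofReal_iff_toReal_le hc'top (hφ0 n x)]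
    refine le_ciInf fun y => ?_
    by_cases hy : y ∈ Metric.ball x δ
    · have h2 : y < n := by
        rw [Metric.mem_ball, Real.dist_eq, abs_lt] at hy
        linarith
      have h3 : c'.toReal ≤ k n y := by
        simp only [hk, Set.indicator_apply, Set.mem_Iio, h2, if_true]
        exact ENNReal.toReal_mono (htop y) (hball y hy).le
      have : 0 ≤ ((n : ℝ≥0) : ℝ) * |x - y| := by positivity
      linarith
    · rw [Metric.mem_ball, not_lt, dist_comm, Real.dist_eq] at hy
      have h3 : c'.toReal ≤ 1 :=
        ENNReal.toReal_le_of_le_ofReal one_pos.le (by simpa using hc'.le.trans (h1 x))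
      have h4 : (1 : ℝ) ≤ n * |x - y| := by
        rw [div_le_iff₀ hδ] at hn2
        exact hn2.trans (by gcongr)
      have h5 := hk0 n y
      simp only [NNReal.coe_natCast]
      linarith
  rw [ENNReal.div_le_iff (by simpa using hFpos) ENNReal.ofReal_ne_top]
  calc ∫⁻ s, h s ≤ ∫⁻ s, liminf (fun n => ENNReal.ofReal (φ n s)) atTop :=
        lintegral_mono_ae hconv
    _ ≤ liminf (fun n => ∫⁻ s, ENNReal.ofReal (φ n s)) atTop :=
        lintegral_liminf_le fun n => (hφL n).continuous.measurable.ennreal_ofReal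
    _ ≤ _ := liminf_le_of_le (by isBoundedDefault) fun b hb => by
        obtain ⟨n, hn⟩ := hb.exists
        exact hn.trans (hbound n)

end RenewalTheorem

/-! ### The law of a cycle -/

section Cycle

variable {Ω E : Type*} [mΩ : MeasurableSpace Ω] [MetricSpace E] [MeasurableSpace E] [BorelSpace E]
  {P : Measure Ω} {X : Ω → ℝ≥0 → E} {T : Ω → ℝ}

/-- A process with right-continuous paths is jointly measurable in the outcome and the time. -/
theorem measurable_uncurry_of_rightCont (hX : ∀ s, Measurable fun ω => X ω s)
    (hc : ∀ ω s, ContinuousWithinAt (X ω) (Set.Ici s) s) :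
    Measurable fun p : Ω × ℝ≥0 => X p.1 p.2 := by
  -- grid points strictly to the right of `s`
  set a : ℕ → ℝ≥0 → ℝ≥0 := fun n s => ((⌊(n + 1) * s⌋₊ : ℝ≥0) + 1) / (n + 1) with ha
  have ha1 : ∀ n s, s ≤ a n s := by
    intro n s
    rw [ha, le_div_iff₀ (by positivity), mul_comm]
    exact (Nat.lt_floor_add_one _).le
  have ha2 : ∀ n s, a n s ≤ s + 1 / (n + 1) := by
    intro n s
    have h : (⌊((n : ℝ≥0) + 1) * s⌋₊ : ℝ≥0) ≤ (n + 1) * s := Nat.floor_le (by positivity)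
    have e : s + 1 / ((n : ℝ≥0) + 1) = ((n + 1) * s + 1) / (n + 1) := by
      rw [add_div, mul_div_cancel_left₀ _ (by positivity)]
    rw [e]
    change (_ + 1) / _ ≤ _
    gcongr
  have hlim : ∀ s, Tendsto (fun n => a n s) atTop (𝓝[≥] s) := by
    intro s
    refine tendsto_nhdsWithin_iff.2 ⟨?_, Eventually.of_forall fun n => ha1 n s⟩
    refine tendsto_of_tendsto_of_tendsto_of_le_of_le tendsto_const_nhds ?_ (fun n => ha1 n s)
      fun n => ha2 n s
    have h := (tendsto_one_div_add_atTop_nhds_zero_nat (𝕜 := ℝ≥0)).const_add s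
    rwa [add_zero] at h
  refine measurable_of_tendsto_metrizable (f := fun n (p : Ω × ℝ≥0) => X p.1 (a n p.2))
    (fun n => ?_) (tendsto_pi_nhds.2 fun p => (hc p.1 p.2).tendsto.comp (hlim p.2))
  have h1 : Measurable fun q : Ω × ℕ => X q.1 (((q.2 : ℝ≥0) + 1) / (n + 1)) :=
    measurable_from_prod_countable_left fun k => hX (((k : ℝ≥0) + 1) / (n + 1))
  exact h1.comp (measurable_fst.prodMk
    (Nat.measurable_floor.comp (measurable_snd.const_mul ((n : ℝ≥0) + 1))))

theorem measurable_uncurry_toNNReal (hX : ∀ s, Measurable fun ω => X ω s)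
    (hc : ∀ ω s, ContinuousWithinAt (X ω) (Set.Ici s) s) :
    Measurable fun p : Ω × ℝ => X p.1 p.2.toNNReal :=
  (measurable_uncurry_of_rightCont hX hc).comp
    (measurable_fst.prodMk (measurable_real_toNNReal.comp measurable_snd))

/-- The probability that the cycle is still running at time `s` and its state is then in `A`; zero
for negative `s`. -/
noncomputable def occupation (P : Measure Ω) (X : Ω → ℝ≥0 → E) (T : Ω → ℝ) (A : Set E) (s : ℝ) :
    ℝ≥0∞ :=
  (Set.Ici 0).indicator (fun s => P {ω | X ω s.toNNReal ∈ A ∧ s < T ω}) s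

/-- The normalized expected time that a cycle spends in a set: the limit law of the regenerative
process. -/
noncomputable def cycleLaw (P : Measure Ω) (X : Ω → ℝ≥0 → E) (T : Ω → ℝ) : Measure E :=
  (ENNReal.ofReal (∫ ω, T ω ∂P))⁻¹ •
    ((P.prod volume).restrict {p : Ω × ℝ | 0 ≤ p.2 ∧ p.2 < T p.1}).map
      fun p => X p.1 p.2.toNNReal

theorem measurableSet_running (hT : Measurable T) :
    MeasurableSet {p : Ω × ℝ | 0 ≤ p.2 ∧ p.2 < T p.1} :=
  (measurableSet_le measurable_const measurable_snd).inter
    (measurableSet_lt measurable_snd (hT.comp measurable_fst))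

theorem lintegral_cycleLaw [SFinite P] (hX : ∀ s, Measurable fun ω => X ω s)
    (hc : ∀ ω s, ContinuousWithinAt (X ω) (Set.Ici s) s) (hT : Measurable T)
    {g : E → ℝ≥0∞} (hg : Measurable g) :
    ∫⁻ x, g x ∂(cycleLaw P X T) = (ENNReal.ofReal (∫ ω, T ω ∂P))⁻¹ *
      ∫⁻ ω, (∫⁻ s : ℝ in Set.Ico 0 (T ω), g (X ω s.toNNReal)) ∂P := by
  have hm := measurable_uncurry_toNNReal hX hc
  rw [cycleLaw, lintegral_smul_measure, smul_eq_mul, lintegral_map hg hm,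
    ← lintegral_indicator (measurableSet_running hT), lintegral_prod]
  · congr 2
    ext ω
    rw [← lintegral_indicator measurableSet_Ico]
    rfl
  · exact ((hg.comp hm).indicator (measurableSet_running hT)).aemeasurable

theorem cycleLaw_apply [SFinite P] (hX : ∀ s, Measurable fun ω => X ω s)
    (hc : ∀ ω s, ContinuousWithinAt (X ω) (Set.Ici s) s) (hT : Measurable T)
    {A : Set E} (hA : MeasurableSet A) :
    cycleLaw P X T A = (∫⁻ s, occupation P X T A s) / ENNReal.ofReal (∫ ω, T ω ∂P) := by
  have hm := measurable_uncurry_toNNReal hX hc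
  rw [cycleLaw, Measure.smul_apply, smul_eq_mul, Measure.map_apply hm hA,
    Measure.restrict_apply (hm hA), Measure.prod_apply_symm ((hm hA).inter
      (measurableSet_running hT)), mul_comm, div_eq_mul_inv]
  congr 2
  ext s
  by_cases hs : 0 ≤ s
  · rw [occupation, Set.indicator_of_mem (by exact hs)]
    congr 1
    ext ω
    simp [hs]
  · rw [occupation, Set.indicator_of_notMem (by exact hs)]
    have : (fun x => (x, s)) ⁻¹' ((fun p : Ω × ℝ => X p.1 p.2.toNNReal) ⁻¹' A
        ∩ {p | 0 ≤ p.2 ∧ p.2 < T p.1}) = (∅ : Set Ω) := by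
      ext ω
      simp [hs]
    rw [this, measure_empty]

theorem isProbabilityMeasure_cycleLaw [SFinite P] (hX : ∀ s, Measurable fun ω => X ω s)
    (hc : ∀ ω s, ContinuousWithinAt (X ω) (Set.Ici s) s) (hT : Measurable T)
    (hTi : Integrable T P) (hT0 : ∀ ω, 0 ≤ T ω) (hpos : 0 < ∫ ω, T ω ∂P) :
    IsProbabilityMeasure (cycleLaw P X T) := by
  refine ⟨?_⟩
  have h := lintegral_cycleLaw (P := P) hX hc hT (g := fun _ => 1) measurable_const
  simp only [lintegral_one, Measure.restrict_apply MeasurableSet.univ, Set.univ_inter,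
    Real.volume_Ico, sub_zero] at h
  rw [h, ← ofReal_integral_eq_lintegral_ofReal hTi (ae_of_all _ hT0)]
  exact ENNReal.inv_mul_cancel (by simpa using hpos) ENNReal.ofReal_ne_top

variable [IsProbabilityMeasure P] {A : Set E}

theorem occupation_le_one {Ω E : Type*} [MeasurableSpace Ω] {P : Measure Ω} [IsProbabilityMeasure P]
    {X : Ω → ℝ≥0 → E} {T : Ω → ℝ} {A : Set E} (s : ℝ) : occupation P X T A s ≤ 1 := by
  unfold occupation
  exact Set.indicator_apply_le' (fun _ => prob_le_one) fun _ => zero_le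

theorem occupation_mono {Ω E : Type*} [MeasurableSpace Ω] {P : Measure Ω} {X : Ω → ℝ≥0 → E}
    {T : Ω → ℝ} {A B : Set E} (h : A ⊆ B) (s : ℝ) :
    occupation P X T A s ≤ occupation P X T B s :=
  Set.indicator_le_indicator (measure_mono fun _ hω => ⟨h hω.1, hω.2⟩)

theorem measurable_occupation (hX : ∀ s, Measurable fun ω => X ω s)
    (hc : ∀ ω s, ContinuousWithinAt (X ω) (Set.Ici s) s) (hT : Measurable T)
    (hA : MeasurableSet A) : Measurable (occupation P X T A) := by
  refine Measurable.indicator ?_ measurableSet_Ici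
  have hm := measurable_uncurry_toNNReal hX hc
  exact measurable_measure_prodMk_right (μ := P)
    (s := {p : Ω × ℝ | X p.1 p.2.toNNReal ∈ A ∧ p.2 < T p.1})
    ((hm hA).inter (measurableSet_lt measurable_snd (hT.comp measurable_fst)))

theorem occupation_add_compl {Ω E : Type*} [MeasurableSpace Ω] [MeasurableSpace E] {P : Measure Ω}
    {X : Ω → ℝ≥0 → E} {T : Ω → ℝ} {A : Set E} (hX : ∀ s, Measurable fun ω => X ω s)
    (hT : Measurable T) (hA : MeasurableSet A) (s : ℝ) :
    occupation P X T A s + occupation P X T Aᶜ s = tailFun (P.map T) s := by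
  by_cases hs : s ∈ Set.Ici (0 : ℝ)
  · simp only [occupation, tailFun, Set.indicator_of_mem hs]
    rw [Measure.map_apply hT measurableSet_Ioi,
      ← measure_inter_add_sdiff (T ⁻¹' Set.Ioi s) (hX s.toNNReal hA)]
    congr 2
    · ext ω; simp [and_comm]
    · ext ω; simp [and_comm]
  · simp only [occupation, tailFun, Set.indicator_of_notMem hs, add_zero]

theorem occupation_lowerSemicontinuous_right {P : Measure Ω} (hX : ∀ s, Measurable fun ω => X ω s)
    (hc : ∀ ω s, ContinuousWithinAt (X ω) (Set.Ici s) s) (hT : Measurable T)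
    {G : Set E} (hG : IsOpen G) (x : ℝ) (c : ℝ≥0∞) (hcx : c < occupation P X T G x) :
    ∀ᶠ y in 𝓝[>] x, c < occupation P X T G y := by
  by_cases hx : x ∈ Set.Ici (0 : ℝ)
  swap
  · rw [occupation, Set.indicator_of_notMem hx] at hcx
    exact absurd hcx not_lt_zero
  by_contra hcon
  rw [not_eventually] at hcon
  simp only [not_lt] at hcon
  obtain ⟨u, hu, huc⟩ := exists_seq_forall_of_frequently hcon
  have hu' := (tendsto_nhdsWithin_iff.1 hu)
  have hmem : ∀ᶠ n in atTop, u n ∈ Set.Ici (0 : ℝ) :=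
    hu'.2.mono fun n hn => le_trans (Set.mem_Ici.1 hx) (le_of_lt (Set.mem_Ioi.1 hn))
  set S : ℝ → Set Ω := fun s => {ω | X ω s.toNNReal ∈ G ∧ s < T ω} with hS
  have hSm : ∀ s, MeasurableSet (S s) := fun s =>
    ((hX _) hG.measurableSet).inter (measurableSet_lt measurable_const hT)
  have hpt : ∀ ω, (S x).indicator 1 ω
      ≤ liminf (fun n => (S (u n)).indicator (1 : Ω → ℝ≥0∞) ω) atTop := by
    intro ω
    by_cases hω : ω ∈ S x
    · rw [Set.indicator_of_mem hω]
      refine le_liminf_of_le (by isBoundedDefault) ?_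
      have ht : Tendsto (fun n => (u n).toNNReal) atTop (𝓝[≥] x.toNNReal) :=
        tendsto_nhdsWithin_iff.2 ⟨(continuous_real_toNNReal.tendsto x).comp hu'.1,
          hu'.2.mono fun n hn => Real.toNNReal_le_toNNReal (le_of_lt (Set.mem_Ioi.1 hn))⟩
      have h1 := ((hc ω x.toNNReal).tendsto.comp ht).eventually (hG.mem_nhds hω.1)
      have h2 := hu'.1.eventually (eventually_lt_nhds hω.2)
      filter_upwards [h1, h2] with n hn1 hn2
      rw [Set.indicator_of_mem (show ω ∈ S (u n) from ⟨hn1, hn2⟩)]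
    · rw [Set.indicator_of_notMem hω]
      exact zero_le
  have hkey : P (S x) ≤ liminf (fun n => P (S (u n))) atTop := by
    calc P (S x) = ∫⁻ ω, (S x).indicator 1 ω ∂P := (lintegral_indicator_one (hSm x)).symm
      _ ≤ ∫⁻ ω, liminf (fun n => (S (u n)).indicator (1 : Ω → ℝ≥0∞) ω) atTop ∂P :=
          lintegral_mono hpt
      _ ≤ liminf (fun n => ∫⁻ ω, (S (u n)).indicator (1 : Ω → ℝ≥0∞) ω ∂P) atTop :=
          lintegral_liminf_le fun n => measurable_one.indicator (hSm _)
      _ = _ := by simp_rw [lintegral_indicator_one (hSm _)]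
  rw [occupation, Set.indicator_of_mem hx] at hcx
  refine absurd (hcx.trans_le hkey) (not_lt.2 ?_)
  refine liminf_le_of_frequently_le' (Eventually.frequently ?_)
  filter_upwards [hmem] with n hn
  have := huc n
  rwa [occupation, Set.indicator_of_mem hn] at this

theorem measure_interior_of_null_frontier {E : Type*} [TopologicalSpace E] [MeasurableSpace E]
    {μ : Measure E} {A : Set E} (hA : μ (frontier A) = 0) :
    μ (interior A) = μ A :=
  le_antisymm (measure_mono interior_subset) <| by
    calc μ A ≤ μ (interior A ∪ frontier A) := measure_mono
          (subset_closure.trans (closure_eq_interior_union_frontier A).subset)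
      _ ≤ μ (interior A) + μ (frontier A) := measure_union_le _ _
      _ = μ (interior A) := by rw [hA, add_zero]

/-- **The limit theorem for one regenerative process**, in terms of potentials: for the sets that
are continuity sets of the limit law, the probability `potential (P.map T) (occupation P X T A) t`
to be in `A` at time `t` converges. -/
theorem tendsto_potential_occupation (hX : ∀ s, Measurable fun ω => X ω s)
    (hc : ∀ ω s, ContinuousWithinAt (X ω) (Set.Ici s) s) (hT : Measurable T)
    (hTi : Integrable T P) (hT0 : ∀ ω, 0 ≤ T ω) (hpos : 0 < ∫ ω, T ω ∂P)
    (hTa : Nonarithmetic T P) (hA : MeasurableSet A) (hfr : cycleLaw P X T (frontier A) = 0) :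
    Tendsto (potential (P.map T) (occupation P X T A)) atTop (𝓝 (cycleLaw P X T A)) := by
  have : IsProbabilityMeasure (P.map T) := Measure.isProbabilityMeasure_map hT.aemeasurable
  have := isProbabilityMeasure_cycleLaw (P := P) hX hc hT hTi hT0 hpos
  have hF0 : ∀ᵐ y ∂(P.map T), 0 ≤ y :=
    (ae_map_iff hT.aemeasurable measurableSet_Ici).2 (ae_of_all _ hT0)
  have hFi : Integrable id (P.map T) :=
    (integrable_map_measure aestronglyMeasurable_id hT.aemeasurable).2 hTi
  have hFm : ∫ y, y ∂(P.map T) = ∫ ω, T ω ∂P :=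
    integral_map hT.aemeasurable aestronglyMeasurable_id
  have hFpos : 0 < ∫ y, y ∂(P.map T) := hFm ▸ hpos
  have hFa : Nonarithmetic id (P.map T) := by
    intro d hd hae
    exact hTa d hd (ae_of_ae_map hT.aemeasurable hae)
  have hopen : ∀ B : Set E, MeasurableSet B → cycleLaw P X T (frontier B) = 0 →
      cycleLaw P X T B ≤ liminf (potential (P.map T) (occupation P X T B)) atTop := by
    intro B hB hBfr
    rw [← measure_interior_of_null_frontier hBfr,
      cycleLaw_apply hX hc hT isOpen_interior.measurableSet, ← hFm]
    refine (le_liminf_potential hFa hF0 hFi hFpos occupation_le_one (fun s hs => ?_)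
      (occupation_lowerSemicontinuous_right hX hc hT isOpen_interior)).trans ?_
    · exact Set.indicator_of_notMem (by simpa using hs) _
    · exact liminf_le_liminf (Eventually.of_forall fun t =>
        potential_mono (occupation_mono interior_subset) t)
  have hsum : ∀ t ≥ 0, potential (P.map T) (occupation P X T A) t
      + potential (P.map T) (occupation P X T Aᶜ) t = 1 := by
    intro t ht
    have hm : Measurable (occupation P X T A) := measurable_occupation hX hc hT hA
    rw [← potential_tailFun_eq_one hF0 hFpos ht, potential, potential, potential,
      ← lintegral_add_left (by fun_prop)]
    simp_rw [occupation_add_compl hX hT hA]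
  have h1 := hopen A hA hfr
  have h2 := hopen Aᶜ hA.compl (by rwa [frontier_compl])
  refine tendsto_order.2 ⟨fun c hcA => eventually_lt_of_lt_liminf (hcA.trans_le h1),
    fun c hcA => ?_⟩
  by_cases hc1 : 1 < c
  · filter_upwards [eventually_ge_atTop 0] with t ht
    exact (le_self_add.trans_eq (hsum t ht)).trans_lt hc1
  · push Not at hc1
    have hlt : 1 - c < cycleLaw P X T Aᶜ := by
      rw [prob_compl_eq_one_sub hA]
      exact ENNReal.sub_lt_of_sub_lt hc1 (Or.inl ENNReal.one_ne_top) (by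
        rwa [ENNReal.sub_sub_cancel ENNReal.one_ne_top prob_le_one])
    filter_upwards [eventually_lt_of_lt_liminf (hlt.trans_le h2), eventually_ge_atTop 0]
      with t ht ht0
    by_contra hcon
    push Not at hcon
    have h3 := hsum t ht0
    refine absurd ht (not_lt.2 (ENNReal.le_sub_of_add_le_right ?_ ?_))
    · exact (hc1.trans_lt ENNReal.one_lt_top).ne
    · rw [← h3, add_comm]
      gcongr

end Cycle

/-! ### The renewal decomposition -/

section Paths

variable {Ω E : Type*} {X : ℕ → Ω → ℝ≥0 → E} {T : ℕ → Ω → ℝ}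

theorem renewalEpoch_succ (n : ℕ) (ω : Ω) :
    renewalEpoch T (n + 1) ω = renewalEpoch T n ω + T n ω :=
  Finset.sum_range_succ _ _

theorem monotone_renewalEpoch (hT0 : ∀ n ω, 0 ≤ T n ω) (ω : Ω) :
    Monotone fun n => renewalEpoch T n ω :=
  monotone_nat_of_le_succ fun n => by
    rw [renewalEpoch_succ]
    linarith [hT0 n ω]

theorem renewalCount_eq (hT0 : ∀ n ω, 0 ≤ T n ω) {v : ℝ≥0} {ω : Ω} {n : ℕ}
    (h1 : renewalEpoch T n ω ≤ v) (h2 : (v : ℝ) < renewalEpoch T (n + 1) ω) :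
    renewalCount T v ω = n := by
  refine IsGreatest.csSup_eq ⟨h1, fun k hk => ?_⟩
  by_contra hcon
  push Not at hcon
  have := monotone_renewalEpoch hT0 ω hcon
  have hk' : renewalEpoch T k ω ≤ v := hk
  change renewalEpoch T (n + 1) ω ≤ renewalEpoch T k ω at this
  linarith

theorem renewalCount_spec (hT0 : ∀ n ω, 0 ≤ T n ω) {v : ℝ≥0} {ω : Ω} {k : ℕ}
    (hk : (v : ℝ) < renewalEpoch T k ω) :
    renewalEpoch T (renewalCount T v ω) ω ≤ v ∧
      (v : ℝ) < renewalEpoch T (renewalCount T v ω + 1) ω ∧ renewalCount T v ω < k := by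
  have hb : ∀ n ∈ {n : ℕ | renewalEpoch T n ω ≤ v}, n < k := by
    intro n hn
    by_contra hcon
    push Not at hcon
    have h1 : renewalEpoch T k ω ≤ renewalEpoch T n ω := monotone_renewalEpoch hT0 ω hcon
    have h2 : renewalEpoch T n ω ≤ v := hn
    linarith
  have hbdd : BddAbove {n : ℕ | renewalEpoch T n ω ≤ v} := ⟨k, fun n hn => (hb n hn).le⟩
  have hmem : renewalCount T v ω ∈ {n : ℕ | renewalEpoch T n ω ≤ v} :=
    Nat.sSup_mem ⟨0, by simp [renewalEpoch]⟩ hbdd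
  refine ⟨hmem, ?_, hb _ hmem⟩
  by_contra hcon
  push Not at hcon
  have : renewalCount T v ω + 1 ≤ renewalCount T v ω := le_csSup hbdd hcon
  omega

/-- The event that cycle `n` is in progress at time `v` and its state is then in `A`. -/
def cycleEvent (X : ℕ → Ω → ℝ≥0 → E) (T : ℕ → Ω → ℝ) (n : ℕ) (v : ℝ≥0) (A : Set E) : Set Ω :=
  {ω | renewalEpoch T n ω ≤ v ∧ (v : ℝ) < renewalEpoch T n ω + T n ω ∧
    X n ω (v - renewalEpoch T n ω).toNNReal ∈ A}

theorem renewalCount_of_mem_cycleEvent (hT0 : ∀ n ω, 0 ≤ T n ω) {n : ℕ} {v : ℝ≥0} {A : Set E}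
    {ω : Ω} (h : ω ∈ cycleEvent X T n v A) : renewalCount T v ω = n :=
  renewalCount_eq hT0 h.1 (by rw [renewalEpoch_succ]; exact h.2.1)

theorem regenProcess_of_mem_cycleEvent (hT0 : ∀ n ω, 0 ≤ T n ω) {n : ℕ} {v : ℝ≥0} {A : Set E}
    {ω : Ω} (h : ω ∈ cycleEvent X T n v A) : regenProcess X T v ω ∈ A := by
  rw [regenProcess, renewalCount_of_mem_cycleEvent hT0 h]
  exact h.2.2

theorem mem_cycleEvent_renewalCount (hT0 : ∀ n ω, 0 ≤ T n ω) {v : ℝ≥0} {A : Set E} {ω : Ω} {k : ℕ}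
    (hk : (v : ℝ) < renewalEpoch T k ω) (h : regenProcess X T v ω ∈ A) :
    ω ∈ cycleEvent X T (renewalCount T v ω) v A := by
  obtain ⟨h1, h2, -⟩ := renewalCount_spec hT0 hk
  exact ⟨h1, by rwa [← renewalEpoch_succ], h⟩

theorem pairwise_disjoint_cycleEvent (hT0 : ∀ n ω, 0 ≤ T n ω) (v : ℝ≥0) (A : Set E) :
    Pairwise (Function.onFun Disjoint fun n => cycleEvent X T n v A) := by
  intro n n' hn
  refine Set.disjoint_left.2 fun ω h h' => hn ?_
  rw [← renewalCount_of_mem_cycleEvent hT0 h, ← renewalCount_of_mem_cycleEvent hT0 h']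

end Paths

section Independence

variable {Ω E : Type*} [mΩ : MeasurableSpace Ω] [MetricSpace E] [MeasurableSpace E] [BorelSpace E]
  {P : Measure Ω} [IsProbabilityMeasure P]

theorem lintegral_comp_of_indepFun {Ω : Type*} [MeasurableSpace Ω] {P : Measure Ω}
    [IsProbabilityMeasure P] {α β : Type*} [MeasurableSpace α] [MeasurableSpace β]
    {f : Ω → α} {g : Ω → β} (hf : Measurable f) (hg : Measurable g) (h : IndepFun f g P)
    {B : α → β → ℝ≥0∞} (hB : Measurable (Function.uncurry B)) :
    ∫⁻ ω, B (f ω) (g ω) ∂P = ∫⁻ ω, ∫⁻ ω', B (f ω) (g ω') ∂P ∂P := by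
  have h1 := (indepFun_iff_map_prod_eq_prod_map_map hf.aemeasurable hg.aemeasurable).1 h
  have : IsProbabilityMeasure (P.map g) := Measure.isProbabilityMeasure_map hg.aemeasurable
  calc ∫⁻ ω, B (f ω) (g ω) ∂P = ∫⁻ p, Function.uncurry B p ∂(P.map fun ω => (f ω, g ω)) :=
        (lintegral_map hB (hf.prodMk hg)).symm
    _ = ∫⁻ a, ∫⁻ b, B a b ∂(P.map g) ∂(P.map f) := by
        rw [h1, lintegral_prod _ hB.aemeasurable]
        rfl
    _ = ∫⁻ ω, ∫⁻ b, B (f ω) b ∂(P.map g) ∂P :=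
        lintegral_map (Measurable.lintegral_prod_right' hB) hf
    _ = _ := by
        refine lintegral_congr fun ω => lintegral_map ?_ hg
        exact hB.comp measurable_prodMk_left

theorem lintegral_mul_comp_add_of_indepFun {Ω : Type*} [MeasurableSpace Ω] {P : Measure Ω}
    [IsProbabilityMeasure P] {α β : Type*} [MeasurableSpace α] [MeasurableSpace β]
    {f : Ω → α} {g : Ω → β} (hf : Measurable f) (hg : Measurable g) (h : IndepFun f g P)
    {W : α → ℝ≥0∞} (hW : Measurable W) {S : α → ℝ} (hS : Measurable S) {T : β → ℝ}
    (hT : Measurable T) {k : ℝ → ℝ≥0∞} (hk : Measurable k) :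
    ∫⁻ ω, W (f ω) * k (S (f ω) + T (g ω)) ∂P
      = ∫⁻ ω, W (f ω) * ∫⁻ y, k (S (f ω) + y) ∂(P.map fun ω => T (g ω)) ∂P := by
  rw [lintegral_comp_of_indepFun hf hg h (B := fun a b => W a * k (S a + T b))]
  · refine lintegral_congr fun ω => ?_
    rw [lintegral_const_mul _ (by fun_prop), lintegral_map (by fun_prop) (by fun_prop)]
  · simp only [Function.uncurry_def]
    fun_prop

/-- If a cycle starts at a time `S` that is independent of the cycle, then given `S` it is running
and has its state in `A` at time `v` with conditional probability `occupation P X T A (v - S)`. -/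
theorem setLIntegral_running_of_indepFun {α β : Type*} [MeasurableSpace α] [MeasurableSpace β]
    {f : Ω → α} {g : Ω → β} (hf : Measurable f) (hg : Measurable g) (h : IndepFun f g P)
    {W : α → ℝ≥0∞} (hW : Measurable W) {S : α → ℝ} (hS : Measurable S) {T : β → ℝ}
    (hT : Measurable T) {X : β → ℝ≥0 → E} (hX : ∀ s, Measurable fun b => X b s)
    (hc : ∀ b s, ContinuousWithinAt (X b) (Set.Ici s) s) {A : Set E} (hA : MeasurableSet A)
    (v : ℝ≥0) :
    ∫⁻ ω in {ω | S (f ω) ≤ v ∧ (v : ℝ) < S (f ω) + T (g ω) ∧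
        X (g ω) (v - S (f ω)).toNNReal ∈ A}, W (f ω) ∂P
      = ∫⁻ ω, W (f ω) *
        occupation P (fun ω => X (g ω)) (fun ω => T (g ω)) A (v - S (f ω)) ∂P := by
  set R : Set (α × β) := {p | S p.1 ≤ v ∧ (v : ℝ) < S p.1 + T p.2 ∧
    X p.2 (v - S p.1).toNNReal ∈ A} with hR
  have hRm : MeasurableSet R := by
    have hS1 : Measurable fun p : α × β => S p.1 := by fun_prop
    have hT2 : Measurable fun p : α × β => T p.2 := by fun_prop
    refine (measurableSet_le hS1 measurable_const).inter
      ((measurableSet_lt measurable_const (hS1.add hT2)).inter ?_)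
    have h1 : Measurable fun p : α × β => X p.2 (v - S p.1).toNNReal :=
      (measurable_uncurry_toNNReal hX hc).comp
        (f := fun p : α × β => (p.2, (v : ℝ) - S p.1)) (by fun_prop)
    exact h1 hA
  have hpre : {ω | S (f ω) ≤ v ∧ (v : ℝ) < S (f ω) + T (g ω) ∧
      X (g ω) (v - S (f ω)).toNNReal ∈ A} = (fun ω => (f ω, g ω)) ⁻¹' R := rfl
  rw [hpre, ← lintegral_indicator ((hf.prodMk hg) hRm)]
  have e1 : ∀ ω, ((fun ω => (f ω, g ω)) ⁻¹' R).indicator (fun ω => W (f ω)) ω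
      = W (f ω) * R.indicator 1 (f ω, g ω) := by
    intro ω
    by_cases hω : (f ω, g ω) ∈ R
    · rw [Set.indicator_of_mem hω, Set.indicator_of_mem (by exact hω)]
      simp
    · rw [Set.indicator_of_notMem hω, Set.indicator_of_notMem (by exact hω)]
      simp
  simp_rw [e1]
  rw [lintegral_comp_of_indepFun hf hg h (B := fun a b => W a * R.indicator 1 (a, b))]
  · refine lintegral_congr fun ω => ?_
    rw [lintegral_const_mul]
    · congr 1
      have hRω : MeasurableSet {ω' | (f ω, g ω') ∈ R} :=
        (measurable_const.prodMk hg) hRm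
      have e2 : ∫⁻ ω', R.indicator 1 (f ω, g ω') ∂P = P {ω' | (f ω, g ω') ∈ R} := by
        rw [← lintegral_indicator_one hRω]
        rfl
      rw [e2, occupation]
      by_cases hs : S (f ω) ≤ v
      · rw [Set.indicator_of_mem (by simpa using hs)]
        congr 1
        ext ω'
        simp only [hR, Set.mem_ofPred_eq, hs, true_and, sub_lt_iff_lt_add']
        exact and_comm
      · rw [Set.indicator_of_notMem (by simpa using hs)]
        have : {ω' | (f ω, g ω') ∈ R} = ∅ := by
          ext ω'
          simp [hR, hs]
        rw [this, measure_empty]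
    · exact (measurable_one.indicator hRm).comp (measurable_const.prodMk hg)
  · exact (hW.comp measurable_fst).mul (measurable_one.indicator hRm)

/-- The σ-algebra generated by the cycles with numbers below `k`. -/
abbrev past {Ω : Type*} (G : ℕ → MeasurableSpace Ω) (k : ℕ) : MeasurableSpace Ω :=
  ⨆ j ∈ Set.Iio k, G j

theorem past_mono {Ω : Type*} {G : ℕ → MeasurableSpace Ω} {k l : ℕ} (h : k ≤ l) :
    past G k ≤ past G l :=
  biSup_mono fun _ hj => lt_of_lt_of_le hj h

theorem le_past {Ω : Type*} {G : ℕ → MeasurableSpace Ω} {j k : ℕ} (h : j < k) :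
    G j ≤ past G k :=
  le_biSup G (show j ∈ Set.Iio k from h)

theorem past_le {G : ℕ → MeasurableSpace Ω} (hG : ∀ n, G n ≤ mΩ) (k : ℕ) : past G k ≤ mΩ :=
  iSup₂_le fun j _ => hG j

theorem indep_past {P : Measure Ω} {G : ℕ → MeasurableSpace Ω} (hG : ∀ n, G n ≤ mΩ)
    (hGi : iIndep G P) (k : ℕ) :
    Indep (past G k) (G k) P := by
  have h := indep_iSup_of_disjoint hG hGi (S := Set.Iio k) (T := {k}) (by simp)
  simpa [past] using h

variable {G : ℕ → MeasurableSpace Ω} {X : ℕ → Ω → ℝ≥0 → E} {T : ℕ → Ω → ℝ}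

theorem measurable_renewalEpoch {Ω : Type*} {G : ℕ → MeasurableSpace Ω} {T : ℕ → Ω → ℝ}
    (hT : ∀ n, Measurable[G n] (T n)) {n k : ℕ} (hnk : n ≤ k) :
    Measurable[past G k] (renewalEpoch T n) := by
  let := past G k
  unfold renewalEpoch
  refine Finset.measurable_fun_sum _ fun j hj => ?_
  exact (hT j).mono (le_past ((Finset.mem_range.1 hj).trans_le hnk)) le_rfl

theorem measurableSet_cycleEvent {Ω : Type*} {G : ℕ → MeasurableSpace Ω} {X : ℕ → Ω → ℝ≥0 → E}
    {T : ℕ → Ω → ℝ} (hX : ∀ n s, Measurable[G n] fun ω => X n ω s)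
    (hT : ∀ n, Measurable[G n] (T n))
    (hc : ∀ n ω s, ContinuousWithinAt (X n ω) (Set.Ici s) s) {n k : ℕ} (hnk : n < k) (v : ℝ≥0)
    {A : Set E} (hA : MeasurableSet A) : MeasurableSet[past G k] (cycleEvent X T n v A) := by
  let := past G k
  have hS : Measurable (renewalEpoch T n) := measurable_renewalEpoch hT hnk.le
  have hTm : Measurable (T n) := (hT n).mono (le_past hnk) le_rfl
  have hXm : ∀ s, Measurable fun ω => X n ω s := fun s => (hX n s).mono (le_past hnk) le_rfl
  refine (measurableSet_le hS measurable_const).inter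
    ((measurableSet_lt measurable_const (hS.add hTm)).inter ?_)
  have h1 : Measurable fun ω => X n ω (v - renewalEpoch T n ω).toNNReal :=
    (measurable_uncurry_toNNReal hXm (hc n)).comp
      (f := fun ω => (ω, (v : ℝ) - renewalEpoch T n ω)) (by fun_prop)
  exact h1 hA

theorem indepFun_id_of_indep {P : Measure Ω} {m₁ m₂ : MeasurableSpace Ω} (h : Indep m₁ m₂ P) :
    @IndepFun Ω Ω Ω mΩ m₁ m₂ id id P := by
  refine (@IndepFun_iff_Indep Ω Ω Ω mΩ m₁ m₂ id id P).2 ?_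
  rw [@MeasurableSpace.comap_id Ω m₁, @MeasurableSpace.comap_id Ω m₂]
  exact h

/-- After the first `k` cycles the renewal epochs continue as an independent random walk with steps
of law `F`. -/
theorem lintegral_mul_comp_renewalEpoch (hG : ∀ n, G n ≤ mΩ) (hGi : iIndep G P)
    (hT : ∀ n, Measurable[G n] (T n)) {F : Measure ℝ} [IsProbabilityMeasure F]
    (hF : ∀ n, P.map (T n) = F) (k : ℕ) {W : Ω → ℝ≥0∞} (hW : Measurable[past G k] W) (j : ℕ)
    {g : ℝ → ℝ≥0∞} (hg : Measurable g) :
    ∫⁻ ω, W ω * g (renewalEpoch T (k + j) ω) ∂P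
      = ∫⁻ ω, W ω * ∫⁻ s, g (renewalEpoch T k ω + s) ∂(convPow F j) ∂P := by
  induction j generalizing g with
  | zero =>
    refine lintegral_congr fun ω => ?_
    change _ = W ω * ∫⁻ s, g (renewalEpoch T k ω + s) ∂(Measure.dirac 0)
    rw [lintegral_dirac' _ (by fun_prop)]
    simp
  | succ j ih =>
    have hind := indepFun_id_of_indep (indep_past hG hGi (k + j))
    have h1 := @lintegral_mul_comp_add_of_indepFun Ω mΩ P _ Ω Ω (past G (k + j)) (G (k + j)) id id
      (measurable_id'' (past_le hG _)) (measurable_id'' (hG _)) hind W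
      (hW.mono (past_mono (Nat.le_add_right _ _)) le_rfl) (renewalEpoch T (k + j))
      (measurable_renewalEpoch hT le_rfl) (T (k + j)) (hT _) g hg
    simp only [id] at h1
    change ∫⁻ ω, W ω * g (renewalEpoch T (k + j + 1) ω) ∂P = _
    simp_rw [renewalEpoch_succ]
    rw [h1]
    have hgm : Measurable fun x => ∫⁻ y, g (x + y) ∂F :=
      Measurable.lintegral_prod_right' (f := fun p : ℝ × ℝ => g (p.1 + p.2)) (by fun_prop)
    have h2 := ih hgm
    have e : P.map (fun ω => T (k + j) ω) = F := hF _
    rw [e, h2]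
    refine lintegral_congr fun ω => ?_
    have : convPow F (j + 1) = (convPow F j).conv F := Measure.conv_comm _ _
    rw [this, Measure.lintegral_conv (by fun_prop)]
    simp_rw [add_assoc]

/-- **The renewal decomposition** given the first `k` cycles. On the event that these are over by
time `v`, the state at time `v` is in `A` with the conditional probability
`potential F h (v - S_k)`. -/
theorem setLIntegral_regenProcess (hG : ∀ n, G n ≤ mΩ) (hGi : iIndep G P)
    (hX : ∀ n s, Measurable[G n] fun ω => X n ω s)
    (hT : ∀ n, Measurable[G n] (T n))
    (hc : ∀ n ω s, ContinuousWithinAt (X n ω) (Set.Ici s) s) (hT0 : ∀ n ω, 0 ≤ T n ω)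
    (hunb : ∀ᵐ ω ∂P, ∀ x : ℝ, ∃ n, x < renewalEpoch T n ω)
    {F : Measure ℝ} [IsProbabilityMeasure F] (hF : ∀ n, P.map (T n) = F)
    {A : Set E} (hA : MeasurableSet A) {h : ℝ → ℝ≥0∞} (hhm : Measurable h)
    (hh : ∀ n, occupation P (X n) (T n) A = h) (k : ℕ) {W : Ω → ℝ≥0∞}
    (hW : Measurable[past G k] W) (v : ℝ≥0) :
    ∫⁻ ω in {ω | regenProcess X T v ω ∈ A ∧ renewalEpoch T k ω ≤ v}, W ω ∂P
      = ∫⁻ ω, W ω * potential F h (v - renewalEpoch T k ω) ∂P := by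
  have hset : ({ω | regenProcess X T v ω ∈ A ∧ renewalEpoch T k ω ≤ v} : Set Ω)
      =ᵐ[P] ⋃ j, cycleEvent X T (k + j) v A := by
    filter_upwards [hunb] with ω hω
    refine propext ⟨fun hmem => ?_, fun hmem => ?_⟩
    · obtain ⟨n, hn⟩ := hω v
      have h1 := mem_cycleEvent_renewalCount hT0 hn hmem.1
      have h2 : k ≤ renewalCount T v ω := by
        by_contra hcon
        push Not at hcon
        have h3 : renewalEpoch T (renewalCount T v ω + 1) ω ≤ renewalEpoch T k ω :=
          monotone_renewalEpoch hT0 ω hcon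
        have h4 := (renewalCount_spec hT0 hn).2.1
        have h5 : renewalEpoch T k ω ≤ v := hmem.2
        linarith
      refine Set.mem_iUnion.2 ⟨renewalCount T v ω - k, ?_⟩
      rwa [Nat.add_sub_cancel' h2]
    · obtain ⟨j, hj⟩ := Set.mem_iUnion.1 hmem
      refine ⟨regenProcess_of_mem_cycleEvent hT0 hj, ?_⟩
      have : renewalEpoch T k ω ≤ renewalEpoch T (k + j) ω :=
        monotone_renewalEpoch hT0 ω (Nat.le_add_right k j)
      exact this.trans hj.1
  have hone : ∀ j, ∫⁻ ω in cycleEvent X T (k + j) v A, W ω ∂P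
      = ∫⁻ ω, W ω * ∫⁻ s, h (v - renewalEpoch T k ω - s) ∂(convPow F j) ∂P := by
    intro j
    have hind := indepFun_id_of_indep (indep_past hG hGi (k + j))
    have h1 := @setLIntegral_running_of_indepFun Ω E mΩ _ _ _ P _ Ω Ω (past G (k + j)) (G (k + j))
      id id (measurable_id'' (past_le hG _)) (measurable_id'' (hG _)) hind W
      (hW.mono (past_mono (Nat.le_add_right _ _)) le_rfl) (renewalEpoch T (k + j))
      (measurable_renewalEpoch hT le_rfl) (T (k + j)) (hT _) (X (k + j)) (hX _) (hc _) A hA v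
    have h2 := lintegral_mul_comp_renewalEpoch hG hGi hT hF k hW j (g := fun x => h (v - x))
      (by fun_prop)
    simp_rw [sub_sub]
    rw [← h2]
    simp only [id] at h1
    rw [← hh (k + j)]
    exact h1
  have hWm : Measurable W := hW.mono (past_le hG k) le_rfl
  rw [setLIntegral_congr hset, lintegral_iUnion]
  · simp_rw [hone, potential_eq_tsum]
    rw [← lintegral_tsum]
    · simp_rw [ENNReal.tsum_mul_left]
    · intro j
      have hSm : Measurable (renewalEpoch T k) :=
        (measurable_renewalEpoch hT le_rfl).mono (past_le hG k) le_rfl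
      have h1 : Measurable fun x => ∫⁻ s, h (x - s) ∂(convPow F j) :=
        Measurable.lintegral_prod_right' (f := fun p : ℝ × ℝ => h (p.1 - p.2)) (by fun_prop)
      exact (hWm.mul (h1.comp (hSm.const_sub _))).aemeasurable
  · exact fun j => past_le hG _ _ (measurableSet_cycleEvent hX hT hc (Nat.lt_succ_self _) v hA)
  · intro i j hij
    exact pairwise_disjoint_cycleEvent hT0 v A (fun h => hij (Nat.add_left_cancel h))

end Independence

/-! ### Law of large numbers and asymptotic independence -/

section Measurability

variable {Ω E : Type*} [MeasurableSpace Ω] [MetricSpace E] [MeasurableSpace E] [BorelSpace E]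
  {X : ℕ → Ω → ℝ≥0 → E} {T : ℕ → Ω → ℝ}

theorem measurable_renewalCount {Ω : Type*} [MeasurableSpace Ω] {T : ℕ → Ω → ℝ}
    (hT : ∀ n, Measurable (T n)) (hT0 : ∀ n ω, 0 ≤ T n ω) (v : ℝ≥0) :
    Measurable (renewalCount T v) := by
  have hS : ∀ n, Measurable (renewalEpoch T n) := fun n =>
    Finset.measurable_fun_sum _ fun j _ => hT j
  refine measurable_to_countable' fun n => ?_
  -- the renewals accumulate before `v` on an event on which `renewalCount` has the junk value `0`
  have : renewalCount T v ⁻¹' {n} = ({ω | renewalEpoch T n ω ≤ v} ∩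
      {ω | (v : ℝ) < renewalEpoch T (n + 1) ω}) ∪
      ({_ω | n = 0} ∩ ⋂ k, {ω | renewalEpoch T k ω ≤ v}) := by
    ext ω
    simp only [Set.mem_preimage, Set.mem_singleton_iff, Set.mem_union, Set.mem_inter_iff,
      Set.mem_ofPred_eq, Set.mem_iInter]
    by_cases hk : ∃ k, (v : ℝ) < renewalEpoch T k ω
    · obtain ⟨k, hk⟩ := hk
      constructor
      · rintro rfl
        exact Or.inl ⟨(renewalCount_spec hT0 hk).1, (renewalCount_spec hT0 hk).2.1⟩
      · rintro (h | h)
        · exact renewalCount_eq hT0 h.1 h.2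
        · exact absurd (h.2 k) (not_le.2 hk)
    · push Not at hk
      have hN : renewalCount T v ω = 0 := by
        have : {n : ℕ | renewalEpoch T n ω ≤ v} = Set.univ := Set.eq_univ_of_forall hk
        rw [renewalCount, this, csSup_of_not_bddAbove (by simp [not_bddAbove_univ])]
        simp
      rw [hN]
      constructor
      · intro h
        exact Or.inr ⟨h.symm, hk⟩
      · rintro (h | h)
        · exact absurd h.2 (not_lt.2 (hk _))
        · exact h.1.symm
  rw [this]
  exact ((measurableSet_le (hS n) measurable_const).inter
    (measurableSet_lt measurable_const (hS _))).union
    ((MeasurableSet.const _).inter (MeasurableSet.iInter fun k =>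
      measurableSet_le (hS k) measurable_const))

theorem measurable_regenProcess (hX : ∀ n s, Measurable fun ω => X n ω s)
    (hT : ∀ n, Measurable (T n)) (hc : ∀ n ω s, ContinuousWithinAt (X n ω) (Set.Ici s) s)
    (hT0 : ∀ n ω, 0 ≤ T n ω) (v : ℝ≥0) : Measurable (regenProcess X T v) := by
  have hS : ∀ n, Measurable (renewalEpoch T n) := fun n =>
    Finset.measurable_fun_sum _ fun j _ => hT j
  have h1 : Measurable fun q : Ω × ℕ =>
      X q.2 q.1 (v - renewalEpoch T q.2 q.1).toNNReal := by
    refine measurable_from_prod_countable_left fun n => ?_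
    exact (measurable_uncurry_toNNReal (hX n) (hc n)).comp
      (f := fun ω => (ω, (v : ℝ) - renewalEpoch T n ω)) (measurable_id.prodMk ((hS n).const_sub _))
  exact h1.comp (measurable_id.prodMk (measurable_renewalCount hT hT0 v))

end Measurability

section LawOfLargeNumbers

variable {Ω : Type*} {T : ℕ → Ω → ℝ}

theorem tendsto_renewalEpoch_div [mΩ : MeasurableSpace Ω] {P : Measure Ω}
    {G : ℕ → MeasurableSpace Ω} (hG : ∀ n, G n ≤ mΩ) (hGi : iIndep G P)
    (hT : ∀ n, Measurable[G n] (T n)) {F : Measure ℝ} (hF : ∀ n, P.map (T n) = F)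
    (hFi : Integrable id F) :
    ∀ᵐ ω ∂P, Tendsto (fun n : ℕ => renewalEpoch T n ω / n) atTop (𝓝 (∫ y, y ∂F)) := by
  have hTm : ∀ n, Measurable (T n) := fun n => (hT n).mono (hG n) le_rfl
  have hi : Integrable (T 0) P := by
    have := (integrable_map_measure (μ := P) (f := T 0) (g := id) aestronglyMeasurable_id
      (hTm 0).aemeasurable).1 (by rwa [hF 0])
    simpa using this
  have hmean : ∫ ω, T 0 ω ∂P = ∫ y, y ∂F := by
    rw [← hF 0]
    exact (integral_map (hTm 0).aemeasurable aestronglyMeasurable_id).symm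
  rw [← hmean]
  refine strong_law_ae_real T hi (fun i j hij => ?_) fun i =>
    ⟨(hTm i).aemeasurable, (hTm 0).aemeasurable, by rw [hF, hF]⟩
  rw [Function.onFun, IndepFun_iff_Indep]
  exact indep_of_indep_of_le_left (indep_of_indep_of_le_right (hGi.indep hij)
    (hT j).comap_le) (hT i).comap_le

theorem ae_forall_exists_lt_renewalEpoch [MeasurableSpace Ω] {P : Measure Ω} {μ : ℝ} (hμ : 0 < μ)
    (h : ∀ᵐ ω ∂P, Tendsto (fun n : ℕ => renewalEpoch T n ω / n) atTop (𝓝 μ)) :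
    ∀ᵐ ω ∂P, ∀ x : ℝ, ∃ n, x < renewalEpoch T n ω := by
  filter_upwards [h] with ω hω x
  have h1 : Tendsto (fun n : ℕ => renewalEpoch T n ω / n * n) atTop atTop :=
    hω.pos_mul_atTop hμ tendsto_natCast_atTop_atTop
  obtain ⟨n, hn, hn0⟩ := ((h1.eventually_gt_atTop x).and (eventually_gt_atTop 0)).exists
  refine ⟨n, ?_⟩
  rwa [div_mul_cancel₀ _ (by positivity)] at hn

theorem tendsto_measureReal_sub [MeasurableSpace Ω] {P : Measure Ω} [IsFiniteMeasure P]
    {ι : Type*} {l : Filter ι} [l.IsCountablyGenerated]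
    {U V : ι → Set Ω} (hU : ∀ t, MeasurableSet (U t)) (hV : ∀ t, MeasurableSet (V t))
    (h : ∀ᵐ ω ∂P, ∀ᶠ t in l, (ω ∈ U t ↔ ω ∈ V t)) :
    Tendsto (fun t => P.real (U t) - P.real (V t)) l (𝓝 0) := by
  have h1 := tendsto_integral_filter_of_dominated_convergence (μ := P) (l := l)
    (F := fun t ω => (U t).indicator (1 : Ω → ℝ) ω - (V t).indicator 1 ω) (f := fun _ => 0)
    (fun _ => 1) (Eventually.of_forall fun t =>
      ((measurable_one.indicator (hU t)).sub
        (measurable_one.indicator (hV t))).aestronglyMeasurable)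
    (Eventually.of_forall fun t => ae_of_all _ fun ω => by
      by_cases hu : ω ∈ U t <;> by_cases hv : ω ∈ V t <;> simp [hu, hv])
    (integrable_const _) (by
      filter_upwards [h] with ω hω
      refine tendsto_const_nhds.congr' ?_
      filter_upwards [hω] with t ht
      by_cases hu : ω ∈ U t
      · simp [hu, ht.1 hu]
      · simp [hu, mt ht.2 hu])
  simp only [integral_zero] at h1
  refine h1.congr fun t => ?_
  rw [integral_sub ((integrable_const 1).indicator (hU t)) ((integrable_const 1).indicator (hV t)),
    integral_indicator_one (hU t), integral_indicator_one (hV t)]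

/-- Epoch number `⌈c * a⌉` is later than time `μ * b`, if `c > 1`, `b ≤ a` and `a` is large. -/
theorem eventually_lt_renewalEpoch_ceil {ω : Ω} {μ c : ℝ} (hμ : 0 < μ) (hc : 1 < c)
    (h : Tendsto (fun n : ℕ => renewalEpoch T n ω / n) atTop (𝓝 μ)) {ι : Type*} {l : Filter ι}
    {a b : ι → ℝ} (ha : Tendsto a l atTop) (hab : ∀ᶠ t in l, b t ≤ a t) :
    ∀ᶠ t in l, μ * b t < renewalEpoch T ⌈c * a t⌉₊ ω := by
  have hk : Tendsto (fun t => ⌈c * a t⌉₊) l atTop :=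
    tendsto_nat_ceil_atTop.comp (ha.const_mul_atTop (by linarith))
  have hlt : μ / c < μ := div_lt_self hμ hc
  filter_upwards [(h.comp hk).eventually (lt_mem_nhds hlt), hab, ha.eventually_gt_atTop 0]
    with t h1 h2 h3
  have hca : 0 < c * a t := by positivity
  have hk0 : (0 : ℝ) < ⌈c * a t⌉₊ := hca.trans_le (Nat.le_ceil _)
  simp only [Function.comp_apply] at h1
  rw [lt_div_iff₀ hk0] at h1
  refine lt_of_le_of_lt ?_ h1
  calc μ * b t ≤ μ * a t := by gcongr
    _ = μ / c * (c * a t) := by field_simp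
    _ ≤ _ := by gcongr; exact Nat.le_ceil _

/-- Time `μ * b` is later than epoch number `⌈c * a⌉` by an arbitrary margin, if `c' > c`,
`c' * a ≤ b` and `a` is large. -/
theorem tendsto_sub_renewalEpoch_ceil {ω : Ω} {μ c c' : ℝ} (hμ : 0 < μ) (hc : 0 < c)
    (hcc' : c < c') (h : Tendsto (fun n : ℕ => renewalEpoch T n ω / n) atTop (𝓝 μ))
    {ι : Type*} {l : Filter ι} {a b : ι → ℝ} (ha : Tendsto a l atTop)
    (hab : ∀ᶠ t in l, c' * a t ≤ b t) :
    Tendsto (fun t => μ * b t - renewalEpoch T ⌈c * a t⌉₊ ω) l atTop := by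
  have hk : Tendsto (fun t => ⌈c * a t⌉₊) l atTop :=
    tendsto_nat_ceil_atTop.comp (ha.const_mul_atTop hc)
  -- a factor `q > 1` with `q * c < c'`
  obtain ⟨q, hq1, hqc⟩ : ∃ q, 1 < q ∧ q < c' / c := exists_between ((one_lt_div hc).2 hcc')
  rw [lt_div_iff₀ hc] at hqc
  have hlt : μ < q * μ := lt_mul_of_one_lt_left hμ hq1
  have hlow : Tendsto (fun t => μ * (c' - q * c) * a t + (-(q * μ))) l atTop :=
    tendsto_atTop_add_const_right _ _ (ha.const_mul_atTop (mul_pos hμ (by linarith)))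
  refine tendsto_atTop_mono' _ ?_ hlow
  filter_upwards [(h.comp hk).eventually (gt_mem_nhds hlt), hab, ha.eventually_gt_atTop 0]
    with t h1 h2 h3
  have hca : 0 < c * a t := by positivity
  have hk0 : (0 : ℝ) < ⌈c * a t⌉₊ := hca.trans_le (Nat.le_ceil _)
  simp only [Function.comp_apply] at h1
  rw [div_lt_iff₀ hk0] at h1
  have h4 : (⌈c * a t⌉₊ : ℝ) ≤ c * a t + 1 := (Nat.ceil_lt_add_one hca.le).le
  have h5 : q * μ * ⌈c * a t⌉₊ ≤ q * μ * (c * a t + 1) := by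
    have : 0 ≤ q * μ := by positivity
    gcongr
  have h6 : μ * (c' * a t) ≤ μ * b t := by gcongr
  linarith

end LawOfLargeNumbers

section Separation

variable {Ω : Type*} [mΩ : MeasurableSpace Ω] {P : Measure Ω} [IsProbabilityMeasure P]
  {ι : Type*} {E : ι → Type*} [∀ i, MetricSpace (E i)] [∀ i, MeasurableSpace (E i)]
  [∀ i, BorelSpace (E i)] {G : ℕ → MeasurableSpace Ω}
  {X : ℕ → (i : ι) → Ω → ℝ≥0 → E i} {T : ℕ → ι → Ω → ℝ}

/-- The regenerative process of the component `i`. -/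
noncomputable abbrev component (X : ℕ → (i : ι) → Ω → ℝ≥0 → E i) (T : ℕ → ι → Ω → ℝ) (i : ι)
    (v : ℝ≥0) (ω : Ω) : E i :=
  regenProcess (fun n => X n i) (fun n => T n i) v ω

/-- **Asymptotic independence.** If the components `j ∈ J` at their times use only cycles with
numbers below `k t`, and the component `i` still has a long way to go at the end of these cycles,
then the component `i` is asymptotically independent of the others. -/
theorem tendsto_measureReal_inter (hG : ∀ n, G n ≤ mΩ) (hGi : iIndep G P)
    (hX : ∀ n i s, Measurable[G n] fun ω => X n i ω s)
    (hT : ∀ n i, Measurable[G n] (T n i))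
    (hc : ∀ n i ω s, ContinuousWithinAt (X n i ω) (Set.Ici s) s) (hT0 : ∀ n i ω, 0 ≤ T n i ω)
    {J : Finset ι} {i : ι} {F : Measure ℝ} [IsProbabilityMeasure F]
    (hF : ∀ n, P.map (T n i) = F)
    (hunb : ∀ᵐ ω ∂P, ∀ x : ℝ, ∃ n, x < renewalEpoch (fun n => T n i) n ω)
    {A : (i : ι) → Set (E i)} (hA : ∀ i, MeasurableSet (A i)) {h : ℝ → ℝ≥0∞} (hhm : Measurable h)
    (hh : ∀ n, occupation P (X n i) (T n i) (A i) = h) (hp1 : ∀ t, potential F h t ≤ 1)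
    {α : ℝ≥0∞} (hα : α ≠ ⊤) (hlim : Tendsto (potential F h) atTop (𝓝 α))
    {l : Filter ℝ≥0} [l.IsCountablyGenerated] {v : ι → ℝ≥0 → ℝ≥0} {k : ℝ≥0 → ℕ}
    (hJ : ∀ j ∈ J, ∀ᵐ ω ∂P, ∀ᶠ t in l, (v j t : ℝ) < renewalEpoch (fun n => T n j) (k t) ω)
    (hi : ∀ᵐ ω ∂P, Tendsto (fun t => (v i t : ℝ) - renewalEpoch (fun n => T n i) (k t) ω) l atTop)
    {β : ℝ}
    (hβ : Tendsto (fun t => P.real {ω | ∀ j ∈ J, component X T j (v j t) ω ∈ A j}) l (𝓝 β)) :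
    Tendsto (fun t => P.real ({ω | ∀ j ∈ J, component X T j (v j t) ω ∈ A j} ∩
      {ω | component X T i (v i t) ω ∈ A i})) l (𝓝 (α.toReal * β)) := by
  have hXm : ∀ n i s, Measurable fun ω => X n i ω s := fun n i s => (hX n i s).mono (hG n) le_rfl
  have hTm : ∀ n i, Measurable (T n i) := fun n i => (hT n i).mono (hG n) le_rfl
  have hYm : ∀ i v, Measurable (component X T i v) := fun i v =>
    measurable_regenProcess (fun n => hXm n i) (fun n => hTm n i) (fun n => hc n i)
      (fun n => hT0 n i) v
  have hSm : ∀ n, Measurable (renewalEpoch (fun n => T n i) n) := fun n =>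
    Finset.measurable_fun_sum _ fun j _ => hTm j i
  set B : ℝ≥0 → Set Ω := fun t => {ω | ∀ j ∈ J, component X T j (v j t) ω ∈ A j} with hB
  set C : ℝ≥0 → Set Ω := fun t => {ω | component X T i (v i t) ω ∈ A i} with hC
  -- the part of `B t` that is decided by the first `k t` cycles
  set W : ℝ≥0 → Set Ω := fun t => ⋂ j ∈ J, ⋃ n ∈ Set.Iio (k t),
    cycleEvent (fun n => X n j) (fun n => T n j) n (v j t) (A j) with hW
  set D : ℝ≥0 → Set Ω := fun t => {ω | component X T i (v i t) ω ∈ A i ∧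
    renewalEpoch (fun n => T n i) (k t) ω ≤ v i t} with hD
  have hBm : ∀ t, MeasurableSet (B t) := fun t => by
    have : B t = ⋂ j ∈ J, component X T j (v j t) ⁻¹' A j := by
      ext ω; simp [hB]
    rw [this]
    exact Finset.measurableSet_biInter _ fun j _ => hYm j _ (hA j)
  have hCm : ∀ t, MeasurableSet (C t) := fun t => hYm i _ (hA i)
  have hDm : ∀ t, MeasurableSet (D t) := fun t =>
    (hYm i _ (hA i)).inter (measurableSet_le (hSm _) measurable_const)
  have hWp : ∀ t, MeasurableSet[past G (k t)] (W t) := fun t =>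
    Finset.measurableSet_biInter _ fun j _ =>
      MeasurableSet.biUnion (Set.to_countable _) fun n hn =>
        measurableSet_cycleEvent (fun n => hX n j) (fun n => hT n j) (fun n => hc n j) hn _ (hA j)
  have hWi : ∀ t, Measurable[past G (k t)] ((W t).indicator (1 : Ω → ℝ≥0∞)) := fun t => by
    let := past G (k t)
    exact measurable_one.indicator (hWp t)
  have hWm : ∀ t, MeasurableSet (W t) := fun t => past_le hG _ _ (hWp t)
  have hJ' : ∀ᵐ ω ∂P, ∀ᶠ t in l, ∀ j ∈ J,
      (v j t : ℝ) < renewalEpoch (fun n => T n j) (k t) ω := by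
    have : ∀ᵐ ω ∂P, ∀ j ∈ J, ∀ᶠ t in l,
        (v j t : ℝ) < renewalEpoch (fun n => T n j) (k t) ω :=
      (Finset.eventually_all J).2 hJ
    filter_upwards [this] with ω hω
    exact (Finset.eventually_all J).2 hω
  have hBW : ∀ᵐ ω ∂P, ∀ᶠ t in l, (ω ∈ W t ↔ ω ∈ B t) := by
    filter_upwards [hJ'] with ω hω
    filter_upwards [hω] with t ht
    simp only [hW, hB, Set.mem_iInter, Set.mem_iUnion, Set.mem_ofPred_eq]
    refine forall₂_congr fun j hj => ⟨?_, fun hmem => ?_⟩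
    · rintro ⟨n, -, hn⟩
      exact regenProcess_of_mem_cycleEvent (fun n => hT0 n j) hn
    · exact ⟨_, (renewalCount_spec (fun n => hT0 n j) (ht j hj)).2.2,
        mem_cycleEvent_renewalCount (fun n => hT0 n j) (ht j hj) hmem⟩
  have hlim1 : Tendsto (fun t => P.real (W t) - P.real (B t)) l (𝓝 0) :=
    tendsto_measureReal_sub hWm hBm hBW
  have hlim2 : Tendsto (fun t => P.real (B t ∩ C t) - P.real (W t ∩ D t)) l (𝓝 0) := by
    refine tendsto_measureReal_sub (fun t => (hBm t).inter (hCm t))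
      (fun t => (hWm t).inter (hDm t)) ?_
    filter_upwards [hBW, hi] with ω h1 h2
    filter_upwards [h1, h2.eventually_ge_atTop 0] with t h3 h4
    rw [Set.mem_inter_iff, Set.mem_inter_iff, h3]
    refine and_congr_right fun _ => ⟨fun h => ⟨h, by linarith⟩, fun h => h.1⟩
  have hpm : Measurable (potential F h) := measurable_potential hhm
  -- the conditional probabilities of the event `C t` given the first `k t` cycles
  set q : ℝ≥0 → Ω → ℝ≥0∞ := fun t ω =>
    potential F h (v i t - renewalEpoch (fun n => T n i) (k t) ω) with hq
  have hqm : ∀ t, Measurable (q t) := fun t => hpm.comp ((hSm _).const_sub _)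
  have hWD : ∀ t, P.real (W t ∩ D t) = ∫ ω, (W t).indicator (fun ω => (q t ω).toReal) ω ∂P := by
    intro t
    have h1 := setLIntegral_regenProcess hG hGi (fun n => hX n i) (fun n => hT n i)
      (fun n => hc n i) (fun n => hT0 n i) hunb hF (hA i) hhm hh (k t)
      (W := (W t).indicator 1) (hWi t) (v i t)
    have h2 : ∫⁻ ω in D t, (W t).indicator 1 ω ∂P = P (W t ∩ D t) := by
      rw [lintegral_indicator_one (hWm t), Measure.restrict_apply (hWm t)]
    have h3 : ∀ ω, (W t).indicator 1 ω * q t ω = (W t).indicator (q t) ω := by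
      intro ω
      by_cases hω : ω ∈ W t <;> simp [hω]
    rw [measureReal_def, ← h2]
    change (∫⁻ ω in D t, (W t).indicator 1 ω ∂P).toReal = _
    rw [h1]
    change (∫⁻ ω, (W t).indicator 1 ω * q t ω ∂P).toReal = _
    simp_rw [h3]
    rw [← integral_toReal ((hqm t).indicator (hWm t)).aemeasurable]
    · refine integral_congr_ae (ae_of_all _ fun ω => ?_)
      by_cases hω : ω ∈ W t <;> simp [hω]
    · refine ae_of_all _ fun ω => lt_of_le_of_lt ?_ ENNReal.one_lt_top
      exact (Set.indicator_le_self _ _ _).trans (hp1 _)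
  have hq1 : ∀ t ω, (q t ω).toReal ≤ 1 := fun t ω =>
    ENNReal.toReal_le_of_le_ofReal one_pos.le (by simpa using hp1 _)
  have hlim3 : Tendsto (fun t => P.real (W t ∩ D t) - α.toReal * P.real (W t)) l (𝓝 0) := by
    have h1 := tendsto_integral_filter_of_dominated_convergence (μ := P) (l := l)
      (F := fun t ω => (W t).indicator (fun ω => (q t ω).toReal - α.toReal) ω) (f := fun _ => 0)
      (fun _ => 1 + α.toReal) (Eventually.of_forall fun t =>
        (((hqm t).ennreal_toReal.sub_const _).indicator (hWm t)).aestronglyMeasurable)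
      (Eventually.of_forall fun t => ae_of_all _ fun ω => by
        refine (norm_indicator_le_norm_self _ _).trans ?_
        rw [Real.norm_eq_abs]
        refine (abs_sub _ _).trans ?_
        rw [abs_of_nonneg ENNReal.toReal_nonneg, abs_of_nonneg ENNReal.toReal_nonneg]
        gcongr
        exact hq1 t ω)
      (integrable_const _) (by
        filter_upwards [hi] with ω hω
        have h2 : Tendsto (fun t => (q t ω).toReal - α.toReal) l (𝓝 0) := by
          have := ((ENNReal.tendsto_toReal hα).comp (hlim.comp hω)).sub_const α.toReal
          rwa [sub_self] at this
        refine squeeze_zero_norm (fun t => norm_indicator_le_norm_self _ _) ?_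
        simpa using h2.norm)
    simp only [integral_zero] at h1
    refine h1.congr fun t => ?_
    have hi1 : Integrable ((W t).indicator fun ω => (q t ω).toReal) P :=
      (Integrable.of_bound (hqm t).ennreal_toReal.aestronglyMeasurable 1 (ae_of_all _ fun ω => by
        rw [Real.norm_eq_abs, abs_of_nonneg ENNReal.toReal_nonneg]
        exact hq1 t ω)).indicator (hWm t)
    have hi2 : Integrable ((W t).indicator fun _ => α.toReal) P :=
      (integrable_const _).indicator (hWm t)
    have h3 : ∫ ω, (W t).indicator (fun _ => α.toReal) ω ∂P = α.toReal * P.real (W t) := by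
      rw [integral_indicator (hWm t), setIntegral_const, smul_eq_mul, mul_comm]
    rw [hWD, ← h3, ← integral_sub hi1 hi2]
    refine integral_congr_ae (ae_of_all _ fun ω => ?_)
    by_cases hω : ω ∈ W t <;> simp [hω]
  have hfin := (hlim2.add hlim3).add ((hlim1.add hβ).const_mul α.toReal)
  simp only [zero_add] at hfin
  refine hfin.congr fun t => ?_
  simp only [hB]
  ring

end Separation

/-! ### Joint convergence in separable spaces -/

section WeakConvergence

/-- Convergence on the boxes formed of continuity sets suffices for weak convergence to a product
measure. -/
theorem tendsto_probabilityMeasure_pi {ι : Type*} [Fintype ι] {E : ι → Type*}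
    [∀ i, MetricSpace (E i)] [∀ i, MeasurableSpace (E i)] [∀ i, BorelSpace (E i)]
    [∀ i, SecondCountableTopology (E i)] {κ : Type*} {l : Filter κ} [l.IsCountablyGenerated]
    {μs : κ → ProbabilityMeasure ((i : ι) → E i)} {ν : (i : ι) → Measure (E i)}
    [∀ i, IsProbabilityMeasure (ν i)]
    (h : ∀ A : (i : ι) → Set (E i), (∀ i, MeasurableSet (A i)) → (∀ i, ν i (frontier (A i)) = 0) →
      Tendsto (fun t => (μs t : Measure ((i : ι) → E i)).real (Set.univ.pi A)) l
        (𝓝 (∏ i, (ν i).real (A i)))) :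
    Tendsto μs l (𝓝 ⟨Measure.pi ν, inferInstance⟩) := by
  refine IsPiSystem.tendsto_probabilityMeasure_of_tendsto_of_mem
    (S := {s | ∃ A : (i : ι) → Set (E i), (∀ i, MeasurableSet (A i)) ∧
      (∀ i, ν i (frontier (A i)) = 0) ∧ s = Set.univ.pi A}) ?_ ?_ ?_ ?_
  · rintro _ ⟨A, hA, hA0, rfl⟩ _ ⟨B, hB, hB0, rfl⟩ -
    refine ⟨fun i => A i ∩ B i, fun i => (hA i).inter (hB i), fun i => ?_,
      Set.pi_inter_distrib.symm⟩
    refine measure_mono_null (frontier_inter_subset _ _) (measure_union_null ?_ ?_)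
    · exact measure_mono_null Set.inter_subset_left (hA0 i)
    · exact measure_mono_null Set.inter_subset_right (hB0 i)
  · rintro _ ⟨A, hA, -, rfl⟩
    exact MeasurableSet.univ_pi hA
  · intro u hu x hx
    obtain ⟨ε, hε, hball⟩ := Metric.isOpen_iff.1 hu x hx
    have hr : ∀ i, ∃ r ∈ Set.Ioo 0 ε, ν i (frontier (Metric.ball (x i) r)) = 0 := fun i => by
      simpa only [Metric.thickening_singleton] using
        exists_null_frontier_thickening (ν i) {x i} hε
    choose r hr hr0 using hr
    refine ⟨Set.univ.pi fun i => Metric.ball (x i) (r i), ⟨_, fun i => measurableSet_ball, hr0,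
      rfl⟩, ?_, fun y hy => hball ?_⟩
    · exact set_pi_mem_nhds Set.finite_univ fun i _ => Metric.ball_mem_nhds _ (hr i).1
    · rw [Metric.mem_ball, dist_pi_lt_iff hε]
      exact fun i => lt_trans (hy i (Set.mem_univ i)) (hr i).2
  · rintro _ ⟨A, hA, hA0, rfl⟩
    rw [← NNReal.tendsto_coe]
    have h1 := h A hA hA0
    have h2 : ∀ ν' : ProbabilityMeasure ((i : ι) → E i),
        (ν' : Measure ((i : ι) → E i)) = Measure.pi ν →
        ((ν' (Set.univ.pi A) : ℝ≥0) : ℝ) = ∏ i, (ν i).real (A i) := fun ν' hν' => by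
      change (ν' : Measure ((i : ι) → E i)).real (Set.univ.pi A) = _
      rw [measureReal_def, hν', Measure.pi_pi, ENNReal.toReal_prod]
      rfl
    rw [← h2 ⟨Measure.pi ν, inferInstance⟩ rfl] at h1
    exact h1

end WeakConvergence

section TimeScales

/-- The condition on the ratio of two time functions, in terms of the approximate numbers `v t / μ`
of cycles. -/
theorem exists_one_lt_mul_le {μ μ' : ℝ} (hμ : 0 < μ) (hμ' : 0 < μ') {v v' : ℝ≥0 → ℝ≥0}
    (h : ENNReal.ofReal (μ / μ') < liminf (fun t => (v t : ℝ≥0∞) / (v' t : ℝ≥0∞)) atTop) :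
    ∃ c > 1, ∀ᶠ t in atTop, c * ((v' t : ℝ) / μ') ≤ (v t : ℝ) / μ := by
  obtain ⟨ρ, h1, h2⟩ := ENNReal.lt_iff_exists_nnreal_btwn.1 h
  have hρ : μ / μ' < ρ := by
    rw [← ENNReal.ofReal_coe_nnreal] at h1
    exact (ENNReal.ofReal_lt_ofReal_iff_of_nonneg (by positivity)).1 h1
  refine ⟨ρ * μ' / μ, ?_, ?_⟩
  · rw [div_lt_iff₀ hμ'] at hρ
    exact (one_lt_div hμ).2 hρ
  · filter_upwards [eventually_lt_of_lt_liminf h2] with t ht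
    have h3 : (ρ : ℝ≥0∞) * v' t < v t := ENNReal.mul_lt_of_lt_div ht
    have h4 : (ρ : ℝ) * v' t ≤ v t := by exact_mod_cast h3.le
    calc ρ * μ' / μ * ((v' t : ℝ) / μ') = (ρ * v' t) / μ := by field_simp
      _ ≤ _ := by gcongr

/-- The approximate numbers of cycles tend to infinity and are asymptotically ordered. -/
theorem tendsto_and_eventually_le {n : ℕ} {μ : Fin (n + 1) → ℝ} (hμ : ∀ i, 0 < μ i)
    {v : Fin (n + 1) → ℝ≥0 → ℝ≥0} (hlast : Tendsto (v (Fin.last n)) atTop atTop)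
    (hratio : ∀ i : Fin n, ∃ c > 1, ∀ᶠ t in atTop,
      c * ((v i.succ t : ℝ) / μ i.succ) ≤ (v i.castSucc t : ℝ) / μ i.castSucc) (i : Fin (n + 1)) :
    Tendsto (fun t => (v i t : ℝ) / μ i) atTop atTop ∧
      ∀ j ≥ i, ∀ᶠ t in atTop, (v j t : ℝ) / μ j ≤ (v i t : ℝ) / μ i := by
  induction i using Fin.reverseInduction with
  | last =>
    refine ⟨(NNReal.tendsto_coe_atTop.2 hlast).atTop_div_const (hμ _), fun j hj => ?_⟩
    rw [Fin.last_le_iff.1 hj]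
    exact Eventually.of_forall fun t => le_rfl
  | cast i ih =>
    obtain ⟨c, hc, hcr⟩ := hratio i
    have hle : ∀ᶠ t in atTop, (v i.succ t : ℝ) / μ i.succ
        ≤ (v i.castSucc t : ℝ) / μ i.castSucc := by
      filter_upwards [hcr] with t ht
      have := hμ i.succ
      exact (le_mul_of_one_le_left (by positivity) hc.le).trans ht
    refine ⟨tendsto_atTop_mono' _ hle ih.1, fun j hj => ?_⟩
    rcases hj.eq_or_lt with h | h
    · rw [h]
      exact Eventually.of_forall fun t => le_rfl
    · filter_upwards [ih.2 j (Fin.castSucc_lt_iff_succ_le.1 h), hle] with t h1 h2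
      exact h1.trans h2

end TimeScales

section JointConvergence

variable {n : ℕ} {E : Fin (n + 1) → Type*} [∀ i, MetricSpace (E i)] [∀ i, MeasurableSpace (E i)]
  [∀ i, BorelSpace (E i)]
  {Ω₀ : Type*} [MeasurableSpace Ω₀] {P₀ : Measure Ω₀} [IsProbabilityMeasure P₀]
  {X₀ : (i : Fin (n + 1)) → Ω₀ → ℝ≥0 → E i} {T₀ : Fin (n + 1) → Ω₀ → ℝ}
  {Ω : Type*} [mΩ : MeasurableSpace Ω] {P : Measure Ω} [IsProbabilityMeasure P]
  {G : ℕ → MeasurableSpace Ω} {X : ℕ → (i : Fin (n + 1)) → Ω → ℝ≥0 → E i}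
  {T : ℕ → Fin (n + 1) → Ω → ℝ} {v : Fin (n + 1) → ℝ≥0 → ℝ≥0}

/-- The probabilities of boxes of continuity sets converge. -/
theorem tendsto_measureReal_component
    (hX₀ : ∀ i s, Measurable fun ω => X₀ i ω s) (hT₀ : ∀ i, Measurable (T₀ i))
    (hc₀ : ∀ i ω s, ContinuousWithinAt (X₀ i ω) (Set.Ici s) s) (hT₀0 : ∀ i ω, 0 ≤ T₀ i ω)
    (hTa : ∀ i, Nonarithmetic (T₀ i) P₀) (hTi : ∀ i, Integrable (T₀ i) P₀)
    (hpos : ∀ i, 0 < ∫ ω, T₀ i ω ∂P₀)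
    (hG : ∀ n, G n ≤ mΩ) (hGi : iIndep G P)
    (hX : ∀ n i s, Measurable[G n] fun ω => X n i ω s)
    (hT : ∀ n i, Measurable[G n] (T n i))
    (hc : ∀ n i ω s, ContinuousWithinAt (X n i ω) (Set.Ici s) s) (hT0 : ∀ n i ω, 0 ≤ T n i ω)
    (hF : ∀ n i, P.map (T n i) = P₀.map (T₀ i))
    (hocc : ∀ n i A, MeasurableSet A →
      occupation P (X n i) (T n i) A = occupation P₀ (X₀ i) (T₀ i) A)
    (hlast : Tendsto (v (Fin.last n)) atTop atTop)
    (hratio : ∀ i : Fin n, ∃ c > 1, ∀ᶠ t in atTop,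
      c * ((v i.succ t : ℝ) / ∫ ω, T₀ i.succ ω ∂P₀)
        ≤ (v i.castSucc t : ℝ) / ∫ ω, T₀ i.castSucc ω ∂P₀)
    {A : (i : Fin (n + 1)) → Set (E i)} (hA : ∀ i, MeasurableSet (A i))
    (hA0 : ∀ i, cycleLaw P₀ (X₀ i) (T₀ i) (frontier (A i)) = 0) (i : Fin (n + 1)) :
    Tendsto (fun t => P.real {ω | ∀ j ∈ Finset.Ici i, component X T j (v j t) ω ∈ A j}) atTop
      (𝓝 (∏ j ∈ Finset.Ici i, (cycleLaw P₀ (X₀ j) (T₀ j)).real (A j))) := by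
  set μ : Fin (n + 1) → ℝ := fun i => ∫ ω, T₀ i ω ∂P₀ with hμ
  have hFp : ∀ i, IsProbabilityMeasure (P₀.map (T₀ i)) := fun i =>
    Measure.isProbabilityMeasure_map (hT₀ i).aemeasurable
  have hπ : ∀ i, IsProbabilityMeasure (cycleLaw P₀ (X₀ i) (T₀ i)) := fun i =>
    isProbabilityMeasure_cycleLaw (hX₀ i) (hc₀ i) (hT₀ i) (hTi i) (hT₀0 i) (hpos i)
  have hF0 : ∀ i, ∀ᵐ y ∂(P₀.map (T₀ i)), 0 ≤ y := fun i =>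
    (ae_map_iff (hT₀ i).aemeasurable measurableSet_Ici).2 (ae_of_all _ (hT₀0 i))
  have hFi : ∀ i, Integrable id (P₀.map (T₀ i)) := fun i =>
    (integrable_map_measure aestronglyMeasurable_id (hT₀ i).aemeasurable).2 (hTi i)
  have hFm : ∀ i, ∫ y, y ∂(P₀.map (T₀ i)) = μ i := fun i =>
    integral_map (hT₀ i).aemeasurable aestronglyMeasurable_id
  have hLLN : ∀ i, ∀ᵐ ω ∂P,
      Tendsto (fun k : ℕ => renewalEpoch (fun n => T n i) k ω / k) atTop (𝓝 (μ i)) := fun i => by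
    rw [← hFm i]
    exact tendsto_renewalEpoch_div hG hGi (fun n => hT n i) (fun n => hF n i) (hFi i)
  have hscale := tendsto_and_eventually_le (μ := μ) hpos hlast hratio
  have hstep : ∀ (i : Fin (n + 1)) (J : Finset (Fin (n + 1))) (k : ℝ≥0 → ℕ) (β : ℝ),
      (∀ j ∈ J, ∀ᵐ ω ∂P, ∀ᶠ t in atTop,
        (v j t : ℝ) < renewalEpoch (fun n => T n j) (k t) ω) →
      (∀ᵐ ω ∂P, Tendsto (fun t => (v i t : ℝ) - renewalEpoch (fun n => T n i) (k t) ω)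
        atTop atTop) →
      Tendsto (fun t => P.real {ω | ∀ j ∈ J, component X T j (v j t) ω ∈ A j}) atTop (𝓝 β) →
      Tendsto (fun t => P.real ({ω | ∀ j ∈ J, component X T j (v j t) ω ∈ A j} ∩
        {ω | component X T i (v i t) ω ∈ A i})) atTop
        (𝓝 ((cycleLaw P₀ (X₀ i) (T₀ i)).real (A i) * β)) := by
    intro i J k β h1 h2 h3
    refine tendsto_measureReal_inter hG hGi hX hT hc hT0 (fun n => hF n i)
      (ae_forall_exists_lt_renewalEpoch (hpos i) (hLLN i)) hA
      (measurable_occupation (hX₀ i) (hc₀ i) (hT₀ i) (hA i)) (fun n => hocc n i _ (hA i))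
      (fun t => ?_) (measure_ne_top _ _)
      (tendsto_potential_occupation (hX₀ i) (hc₀ i) (hT₀ i) (hTi i) (hT₀0 i) (hpos i) (hTa i)
        (hA i) (hA0 i)) h1 h2 h3
    refine (potential_mono (fun s => ?_) t).trans (potential_tailFun_le_one (hF0 i) t)
    rw [← occupation_add_compl (hX₀ i) (hT₀ i) (hA i)]
    exact le_self_add
  induction i using Fin.reverseInduction with
  | last =>
    have h := hstep (Fin.last n) ∅ (fun _ => 0) 1 (by simp) (ae_of_all _ fun ω => by
      simpa [renewalEpoch] using hlast) (by simp)
    have e : Finset.Ici (Fin.last n) = {Fin.last n} := by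
      ext j
      simp [Fin.last_le_iff]
    rw [e]
    simpa using h
  | cast i ih =>
    obtain ⟨c, hc1, hcr⟩ := hratio i
    have ha := (hscale i.succ).1
    -- a number of cycles strictly between those of the components `i + 1` and `i`
    have h := hstep i.castSucc (Finset.Ici i.succ)
      (fun t => ⌈(1 + c) / 2 * ((v i.succ t : ℝ) / μ i.succ)⌉₊) _ (fun j hj => by
        filter_upwards [hLLN j] with ω hω
        have h1 := eventually_lt_renewalEpoch_ceil (c := (1 + c) / 2) (hpos j) (by linarith) hω ha
          ((hscale i.succ).2 j (Finset.mem_Ici.1 hj))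
        filter_upwards [h1] with t ht
        rwa [mul_div_cancel₀ _ (hpos j).ne'] at ht) (by
        filter_upwards [hLLN i.castSucc] with ω hω
        have h1 := tendsto_sub_renewalEpoch_ceil (c := (1 + c) / 2) (c' := c) (hpos i.castSucc)
          (by linarith) (by linarith) hω ha hcr
        refine h1.congr fun t => ?_
        rw [mul_div_cancel₀ _ (hpos i.castSucc).ne']) ih
    have e : Finset.Ici i.castSucc = insert i.castSucc (Finset.Ici i.succ) := by
      ext j
      simp only [Finset.mem_Ici, Finset.mem_insert, Fin.le_def, Fin.ext_iff, Fin.val_castSucc,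
        Fin.val_succ]
      omega
    have hni : i.castSucc ∉ Finset.Ici i.succ := by
      simp [Fin.le_def]
    rw [e, Finset.prod_insert hni]
    refine h.congr fun t => ?_
    congr 1
    ext ω
    simp only [Set.mem_inter_iff, Set.mem_ofPred_eq, Finset.mem_insert, forall_eq_or_imp]
    exact and_comm

/-- **The joint limit theorem** for separable state spaces and cycles without exceptional paths. -/
theorem tendstoInDistribution_component [∀ i, SecondCountableTopology (E i)]
    (hX₀ : ∀ i s, Measurable fun ω => X₀ i ω s) (hT₀ : ∀ i, Measurable (T₀ i))
    (hc₀ : ∀ i ω s, ContinuousWithinAt (X₀ i ω) (Set.Ici s) s) (hT₀0 : ∀ i ω, 0 ≤ T₀ i ω)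
    (hTa : ∀ i, Nonarithmetic (T₀ i) P₀) (hTi : ∀ i, Integrable (T₀ i) P₀)
    (hpos : ∀ i, 0 < ∫ ω, T₀ i ω ∂P₀)
    (hG : ∀ n, G n ≤ mΩ) (hGi : iIndep G P)
    (hX : ∀ n i s, Measurable[G n] fun ω => X n i ω s)
    (hT : ∀ n i, Measurable[G n] (T n i))
    (hc : ∀ n i ω s, ContinuousWithinAt (X n i ω) (Set.Ici s) s) (hT0 : ∀ n i ω, 0 ≤ T n i ω)
    (hF : ∀ n i, P.map (T n i) = P₀.map (T₀ i))
    (hocc : ∀ n i A, MeasurableSet A →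
      occupation P (X n i) (T n i) A = occupation P₀ (X₀ i) (T₀ i) A)
    (hlast : Tendsto (v (Fin.last n)) atTop atTop)
    (hratio : ∀ i : Fin n, ∃ c > 1, ∀ᶠ t in atTop,
      c * ((v i.succ t : ℝ) / ∫ ω, T₀ i.succ ω ∂P₀)
        ≤ (v i.castSucc t : ℝ) / ∫ ω, T₀ i.castSucc ω ∂P₀)
    [∀ i, IsProbabilityMeasure (cycleLaw P₀ (X₀ i) (T₀ i))] :
    TendstoInDistribution (fun t ω i => component X T i (v i t) ω) atTop
      (id : ((i : Fin (n + 1)) → E i) → (i : Fin (n + 1)) → E i) (fun _ => P)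
      (Measure.pi fun i => cycleLaw P₀ (X₀ i) (T₀ i)) := by
  have hYm : ∀ t, Measurable fun ω i => component X T i (v i t) ω := fun t =>
    measurable_pi_lambda _ fun i =>
      measurable_regenProcess (fun n s => (hX n i s).mono (hG n) le_rfl)
        (fun n => (hT n i).mono (hG n) le_rfl) (fun n => hc n i) (fun n => hT0 n i) _
  refine ⟨fun t => (hYm t).aemeasurable, aemeasurable_id, ?_⟩
  have key := tendsto_probabilityMeasure_pi (l := (atTop : Filter ℝ≥0))
    (ν := fun i => cycleLaw P₀ (X₀ i) (T₀ i))
    (μs := fun t => ⟨P.map fun ω i => component X T i (v i t) ω,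
      Measure.isProbabilityMeasure_map (hYm t).aemeasurable⟩) (fun A hA hA0 => by
      have h := tendsto_measureReal_component hX₀ hT₀ hc₀ hT₀0 hTa hTi hpos hG hGi hX hT hc hT0 hF
        hocc hlast hratio hA hA0 0
      have e : Finset.Ici (0 : Fin (n + 1)) = Finset.univ := by
        ext j
        simp
      rw [e] at h
      refine h.congr fun t => ?_
      change _ = (P.map fun ω i => component X T i (v i t) ω).real (Set.univ.pi A)
      rw [map_measureReal_apply (hYm t) (MeasurableSet.univ_pi hA)]
      congr 1
      ext ω
      simp)
  convert key using 2
  simp [Measure.map_id]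

end JointConvergence

/-! ### Reduction to separable spaces and regular paths -/

section Modification

/-- A property that holds almost surely holds everywhere after a measurable change of the outcomes
in a null set. -/
theorem exists_measurable_modification {Ω : Type*} [MeasurableSpace Ω] {P : Measure Ω}
    [IsProbabilityMeasure P] {p : Ω → Prop} (hp : ∀ᵐ ω ∂P, p ω) :
    ∃ φ : Ω → Ω, Measurable φ ∧ (∀ᵐ ω ∂P, φ ω = ω) ∧ ∀ ω, p (φ ω) := by
  classical
  obtain ⟨ω₀, hω₀⟩ := hp.exists
  set N := toMeasurable P {ω | ¬ p ω} with hN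
  have hN0 : P N = 0 := by rw [hN, measure_toMeasurable]; exact hp
  refine ⟨fun ω => if ω ∈ N then ω₀ else ω,
    Measurable.ite (measurableSet_toMeasurable _ _) measurable_const measurable_id, ?_, fun ω => ?_⟩
  · filter_upwards [measure_eq_zero_iff_ae_notMem.1 hN0] with ω hω
    rw [if_neg hω]
  · by_cases hω : ω ∈ N
    · simpa only [if_pos hω] using hω₀
    · simp only [if_neg hω]
      by_contra hcon
      exact hω (subset_toMeasurable _ _ hcon)

/-- A right-continuous path stays in a closed set if it is in this set at a dense set of times. -/
theorem mem_of_rightCont {E : Type*} [TopologicalSpace E] {x : ℝ≥0 → E}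
    (hx : ∀ s, ContinuousWithinAt x (Set.Ici s) s) {D : Set ℝ≥0} (hD : Dense D) {C : Set E}
    (hC : IsClosed C) (h : ∀ s ∈ D, x s ∈ C) (s : ℝ≥0) : x s ∈ C := by
  have h1 : s ∈ closure (Set.Ioi s ∩ D) := by
    have h2 : closure (Set.Ioi s) ⊆ closure (Set.Ioi s ∩ D) :=
      closure_minimal (hD.open_subset_closure_inter isOpen_Ioi) isClosed_closure
    exact h2 (by rw [closure_Ioi]; exact Set.self_mem_Ici)
  have h3 : ContinuousWithinAt x (Set.Ioi s ∩ D) s :=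
    (hx s).mono (Set.inter_subset_left.trans Set.Ioi_subset_Ici_self)
  rw [← hC.closure_eq]
  exact h3.mem_closure h1 fun y hy => h y hy.2

end Modification

end RegenProduct

theorem theorem1 {m : ℕ} (hm : 2 ≤ m)
    {E : Fin m → Type u} [∀ i, MetricSpace (E i)] [∀ i, MeasurableSpace (E i)]
    [∀ i, BorelSpace (E i)]
    -- the generic vector of cycles and cycle lengths
    {Ω₀ : Type*} [MeasurableSpace Ω₀] (P₀ : Measure Ω₀) [IsProbabilityMeasure P₀]
    (X₀ : (i : Fin m) → Ω₀ → ℝ≥0 → E i) (T₀ : Fin m → Ω₀ → ℝ)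
    (hX₀_meas : ∀ i s, StronglyMeasurable fun ω => X₀ i ω s)
    (hT₀_meas : ∀ i, Measurable (T₀ i))
    (hX₀_cont : ∀ i, ∀ᵐ ω ∂P₀, ∀ s : ℝ≥0, ContinuousWithinAt (X₀ i ω) (Set.Ici s) s)
    (hT₀_nonneg : ∀ i, ∀ᵐ ω ∂P₀, 0 ≤ T₀ i ω)
    (hT₀_nonarith : ∀ i, RegenProduct.Nonarithmetic (T₀ i) P₀)
    (hT₀_int : ∀ i, Integrable (T₀ i) P₀)
    (μ : Fin m → ℝ) (hμ : ∀ i, μ i = ∫ ω, T₀ i ω ∂P₀) (hμ_pos : ∀ i, 0 < μ i)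
    -- the i.i.d. sequence of vectors distributed like the generic one
    {Ω : Type*} [MeasurableSpace Ω] (P : Measure Ω) [IsProbabilityMeasure P]
    (X : ℕ → (i : Fin m) → Ω → ℝ≥0 → E i) (T : ℕ → Fin m → Ω → ℝ)
    (hX_meas : ∀ n i s, StronglyMeasurable fun ω => X n i ω s)
    (hT_meas : ∀ n i, Measurable (T n i))
    (hX_cont : ∀ n i, ∀ᵐ ω ∂P, ∀ s : ℝ≥0, ContinuousWithinAt (X n i ω) (Set.Ici s) s)
    (h_indep : iIndepFun (fun (n : ℕ) (ω : Ω) (i : Fin m) => (X n i ω, T n i ω)) P)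
    (h_ident : ∀ n, IdentDistrib (fun (ω : Ω) (i : Fin m) => (X n i ω, T n i ω))
      (fun (ω : Ω₀) (i : Fin m) => (X₀ i ω, T₀ i ω)) P P₀)
    -- the order of the means and the time functions
    (hμ_mono : Monotone μ)
    (v : Fin m → ℝ≥0 → ℝ≥0) (hv_meas : ∀ i, Measurable (v i))
    (hv_last : ∀ i : Fin m, (i : ℕ) + 1 = m → Tendsto (v i) atTop atTop)
    (hv_ratio : ∀ i j : Fin m, (j : ℕ) = (i : ℕ) + 1 →
      ENNReal.ofReal (μ i / μ j) < liminf (fun t => (v i t : ℝ≥0∞) / (v j t : ℝ≥0∞)) atTop) :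
    ∃ (Ω' : Type u) (_ : MeasurableSpace Ω') (P' : Measure Ω') (_ : IsProbabilityMeasure P')
      (Z : (i : Fin m) → Ω' → E i),
      (∀ i, StronglyMeasurable (Z i)) ∧
      iIndepFun Z P' ∧
      (∀ (i : Fin m) (g : E i → ℝ≥0∞), Measurable g →
        ∫⁻ ω, g (Z i ω) ∂P' = (ENNReal.ofReal (μ i))⁻¹ *
          ∫⁻ ω, (∫⁻ s : ℝ in Set.Ico 0 (T₀ i ω), g (X₀ i ω s.toNNReal)) ∂P₀) ∧
      RegenProduct.ConvergesInDistribution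
        (fun (t : ℝ≥0) (ω : Ω) (i : Fin m) =>
          RegenProduct.regenProcess (fun n => X n i) (fun n => T n i) (v i t) ω)
        atTop (fun (ω : Ω') (i : Fin m) => Z i ω) P P' := by
  obtain ⟨n, rfl⟩ : ∃ n, m = n + 1 := ⟨m - 1, by omega⟩
  -- closed separable subsets that contain all the paths outside a null set
  obtain ⟨D, hDc, hDd⟩ := TopologicalSpace.exists_countable_dense ℝ≥0
  set S : (i : Fin (n + 1)) → Set (E i) := fun i =>
    (⋃ s ∈ D, Set.range fun ω => X₀ i ω s) ∪
      ⋃ k : ℕ, ⋃ s ∈ D, Set.range fun ω => X k i ω s with hS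
  set C : (i : Fin (n + 1)) → Set (E i) := fun i => closure (S i) with hC
  have hCsep : ∀ i, TopologicalSpace.IsSeparable (C i) := fun i => by
    have := hDc.to_subtype
    refine (TopologicalSpace.IsSeparable.union ?_ ?_).closure
    · rw [Set.biUnion_eq_iUnion]
      exact TopologicalSpace.IsSeparable.iUnion fun s => (hX₀_meas i s).isSeparable_range
    · refine TopologicalSpace.IsSeparable.iUnion fun k => ?_
      rw [Set.biUnion_eq_iUnion]
      exact TopologicalSpace.IsSeparable.iUnion fun s => (hX_meas k i s).isSeparable_range
  have hC2 : ∀ i, SecondCountableTopology (C i) := fun i =>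
    have := (hCsep i).separableSpace
    UniformSpace.secondCountable_of_separable _
  have hCcl : ∀ i, IsClosed (C i) := fun i => isClosed_closure
  -- modifications without exceptional outcomes
  obtain ⟨φ₀, hφ₀m, hφ₀, hgood₀⟩ := RegenProduct.exists_measurable_modification (P := P₀)
    (p := fun ω => ∀ i, (∀ s : ℝ≥0, ContinuousWithinAt (X₀ i ω) (Set.Ici s) s) ∧ 0 ≤ T₀ i ω)
    (ae_all_iff.2 fun i => (hX₀_cont i).and (hT₀_nonneg i))
  have hident : ∀ k i, IdentDistrib (fun ω => (X k i ω, T k i ω))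
      (fun ω => (X₀ i ω, T₀ i ω)) P P₀ :=
    fun k i => (h_ident k).comp (u := fun p => p i) (measurable_pi_apply i)
  have hidentT : ∀ k i, IdentDistrib (T k i) (T₀ i) P P₀ := fun k i =>
    (hident k i).comp (u := Prod.snd) measurable_snd
  have hT_nonneg : ∀ k i, ∀ᵐ ω ∂P, 0 ≤ T k i ω := fun k i =>
    (hidentT k i).symm.ae_snd (p := fun x => 0 ≤ x) measurableSet_Ici (hT₀_nonneg i)
  obtain ⟨φ, hφm, hφ, hgood⟩ := RegenProduct.exists_measurable_modification (P := P)
    (p := fun ω => ∀ k i, (∀ s : ℝ≥0, ContinuousWithinAt (X k i ω) (Set.Ici s) s) ∧ 0 ≤ T k i ω)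
    (ae_all_iff.2 fun k => ae_all_iff.2 fun i => (hX_cont k i).and (hT_nonneg k i))
  have hmem₀ : ∀ i ω s, X₀ i (φ₀ ω) s ∈ C i := fun i ω s =>
    RegenProduct.mem_of_rightCont (hgood₀ ω i).1 hDd (hCcl i) (fun s hs =>
      subset_closure (Or.inl (Set.mem_biUnion hs ⟨_, rfl⟩))) s
  have hmem : ∀ k i ω s, X k i (φ ω) s ∈ C i := fun k i ω s =>
    RegenProduct.mem_of_rightCont (hgood ω k i).1 hDd (hCcl i) (fun s hs =>
      subset_closure (Or.inr (Set.mem_iUnion.2 ⟨k, Set.mem_biUnion hs ⟨_, rfl⟩⟩))) s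
  set X₀' : (i : Fin (n + 1)) → Ω₀ → ℝ≥0 → C i := fun i ω s => ⟨X₀ i (φ₀ ω) s, hmem₀ i ω s⟩
    with hX₀'
  set T₀' : Fin (n + 1) → Ω₀ → ℝ := fun i ω => T₀ i (φ₀ ω) with hT₀'
  set X' : ℕ → (i : Fin (n + 1)) → Ω → ℝ≥0 → C i := fun k i ω s => ⟨X k i (φ ω) s, hmem k i ω s⟩
    with hX'
  set T' : ℕ → Fin (n + 1) → Ω → ℝ := fun k i ω => T k i (φ ω) with hT'
  have hTae₀ : ∀ i, T₀' i =ᵐ[P₀] T₀ i := fun i => by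
    filter_upwards [hφ₀] with ω hω
    rw [hT₀']
    simp only [hω]
  have hTae : ∀ k i, T' k i =ᵐ[P] T k i := fun k i => by
    filter_upwards [hφ] with ω hω
    rw [hT']
    simp only [hω]
  have hmean : ∀ i, ∫ ω, T₀' i ω ∂P₀ = μ i := fun i => by
    rw [hμ i, integral_congr_ae (hTae₀ i)]
  -- the cycles generate independent σ-algebras
  set f : ℕ → Ω → (i : Fin (n + 1)) → (ℝ≥0 → E i) × ℝ :=
    fun k ω i => (X k i (φ ω), T k i (φ ω)) with hf
  have hfm : ∀ k, Measurable (f k) := fun k =>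
    measurable_pi_lambda _ fun i => (measurable_pi_lambda _ fun s =>
      ((hX_meas k i s).measurable.comp hφm)).prodMk ((hT_meas k i).comp hφm)
  have hfi : iIndepFun f P := h_indep.congr fun k => by
    filter_upwards [hφ] with ω hω
    simp only [hf, hω]
  have hpath : ∀ k i s, Measurable[MeasurableSpace.comap (f k) inferInstance]
      fun ω => X k i (φ ω) s := fun k i s => by
    have h1 : Measurable fun p : (i : Fin (n + 1)) → (ℝ≥0 → E i) × ℝ => (p i).1 s :=
      (measurable_pi_apply s).comp (measurable_fst.comp (measurable_pi_apply i))
    exact h1.comp (comap_measurable (f k))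
  have hlen : ∀ k i, Measurable[MeasurableSpace.comap (f k) inferInstance]
      (T' k i) := fun k i => by
    have h1 : Measurable fun p : (i : Fin (n + 1)) → (ℝ≥0 → E i) × ℝ => (p i).2 :=
      measurable_snd.comp (measurable_pi_apply i)
    exact h1.comp (comap_measurable (f k))
  have hX₀'m : ∀ i s, Measurable fun ω => X₀' i ω s := fun i s =>
    ((hX₀_meas i s).measurable.comp hφ₀m).subtype_mk
  have hT₀'m : ∀ i, Measurable (T₀' i) := fun i => (hT₀_meas i).comp hφ₀m
  have hX₀'c : ∀ i ω s, ContinuousWithinAt (X₀' i ω) (Set.Ici s) s := fun i ω s =>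
    Topology.IsInducing.subtypeVal.continuousWithinAt_iff.2 ((hgood₀ ω i).1 s)
  have hpos : ∀ i, 0 < ∫ ω, T₀' i ω ∂P₀ := fun i => by rw [hmean]; exact hμ_pos i
  have hTi : ∀ i, Integrable (T₀' i) P₀ := fun i => (hT₀_int i).congr (hTae₀ i).symm
  have hπ : ∀ i, IsProbabilityMeasure (RegenProduct.cycleLaw P₀ (X₀' i) (T₀' i)) := fun i =>
    RegenProduct.isProbabilityMeasure_cycleLaw (hX₀'m i) (hX₀'c i) (hT₀'m i) (hTi i)
      (fun ω => (hgood₀ ω i).2) (hpos i)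
  have hocc : ∀ k i A, MeasurableSet A → RegenProduct.occupation P (X' k i) (T' k i) A
      = RegenProduct.occupation P₀ (X₀' i) (T₀' i) A := by
    intro k i A hA
    obtain ⟨B, hB, rfl⟩ := hA
    ext s
    have heval : Measurable fun p : (ℝ≥0 → E i) × ℝ => p.1 s.toNNReal :=
      (measurable_pi_apply s.toNNReal).comp measurable_fst
    have hR : MeasurableSet {p : (ℝ≥0 → E i) × ℝ | p.1 s.toNNReal ∈ B ∧ s < p.2} :=
      (heval hB).inter (measurableSet_lt measurable_const measurable_snd)
    have h1 : P {ω | X' k i ω s.toNNReal ∈ Subtype.val ⁻¹' B ∧ s < T' k i ω}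
        = P {ω | (X k i ω, T k i ω) ∈ {p : (ℝ≥0 → E i) × ℝ | p.1 s.toNNReal ∈ B ∧ s < p.2}} := by
      refine measure_congr ?_
      filter_upwards [hφ] with ω hω
      refine propext ?_
      change X k i (φ ω) s.toNNReal ∈ B ∧ s < T k i (φ ω) ↔ X k i ω s.toNNReal ∈ B ∧ s < T k i ω
      rw [hω]
    have h2 : P₀ {ω | X₀' i ω s.toNNReal ∈ Subtype.val ⁻¹' B ∧ s < T₀' i ω}
        = P₀ {ω | (X₀ i ω, T₀ i ω) ∈ {p : (ℝ≥0 → E i) × ℝ | p.1 s.toNNReal ∈ B ∧ s < p.2}} := by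
      refine measure_congr ?_
      filter_upwards [hφ₀] with ω hω
      refine propext ?_
      change X₀ i (φ₀ ω) s.toNNReal ∈ B ∧ s < T₀ i (φ₀ ω) ↔ X₀ i ω s.toNNReal ∈ B ∧ s < T₀ i ω
      rw [hω]
    have h3 : P {ω | X' k i ω s.toNNReal ∈ Subtype.val ⁻¹' B ∧ s < T' k i ω}
        = P₀ {ω | X₀' i ω s.toNNReal ∈ Subtype.val ⁻¹' B ∧ s < T₀' i ω} := by
      rw [h1, h2]
      exact (hident k i).measure_mem_eq hR
    simp only [RegenProduct.occupation, Set.indicator_apply]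
    rw [h3]
  have hconv := RegenProduct.tendstoInDistribution_component (P₀ := P₀) (P := P) (X₀ := X₀')
    (T₀ := T₀') (X := X') (T := T') (v := v)
    (G := fun k => MeasurableSpace.comap (f k) inferInstance) hX₀'m hT₀'m hX₀'c
    (fun i ω => (hgood₀ ω i).2)
    (fun i d hd hae => hT₀_nonarith i d hd (by
      filter_upwards [hae, hTae₀ i] with ω h1 h2
      rwa [← h2])) hTi hpos (fun k => (hfm k).comap_le)
    ((iIndepFun_iff_iIndep _ _ _).1 hfi) (fun k i s => (hpath k i s).subtype_mk) hlen
    (fun k i ω s => Topology.IsInducing.subtypeVal.continuousWithinAt_iff.2 ((hgood ω k i).1 s))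
    (fun k i ω => (hgood ω k i).2)
    (fun k i => by
      rw [Measure.map_congr (hTae k i), Measure.map_congr (hTae₀ i)]
      exact (hidentT k i).map_eq)
    hocc (hv_last _ rfl) (fun i => by
      rw [hmean, hmean]
      exact RegenProduct.exists_one_lt_mul_le (hμ_pos _) (hμ_pos _)
        (hv_ratio i.castSucc i.succ (by simp)))
  refine ⟨(i : Fin (n + 1)) → C i, inferInstance,
    Measure.pi fun i => RegenProduct.cycleLaw P₀ (X₀' i) (T₀' i), inferInstance,
    fun i z => (z i : E i), fun i => ?_, ?_, fun i g hg => ?_, ?_⟩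
  · exact continuous_subtype_val.comp_stronglyMeasurable (measurable_pi_apply i).stronglyMeasurable
  · exact iIndepFun_pi (X := fun i (z : C i) => (z : E i)) fun i =>
      measurable_subtype_coe.aemeasurable
  · rw [(measurePreserving_eval
        (fun i => RegenProduct.cycleLaw P₀ (X₀' i) (T₀' i)) i).lintegral_comp
      (f := fun z : C i => g z) (hg.comp measurable_subtype_coe),
      RegenProduct.lintegral_cycleLaw (P := P₀) (g := fun z : C i => g z) (hX₀'m i) (hX₀'c i)
        (hT₀'m i) (hg.comp measurable_subtype_coe), hmean]
    congr 1
    refine lintegral_congr_ae ?_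
    filter_upwards [hφ₀] with ω hω
    simp only [hX₀', hT₀', hω]
  · let : MeasurableSpace ((i : Fin (n + 1)) → E i) := borel _
    have : BorelSpace ((i : Fin (n + 1)) → E i) := ⟨rfl⟩
    have hg : Continuous fun (z : (i : Fin (n + 1)) → C i) (i : Fin (n + 1)) => (z i : E i) := by
      fun_prop
    refine (hconv.continuous_comp hg).congr (fun t => ?_) (ae_of_all _ fun z => rfl)
    filter_upwards [hφ] with ω hω
    change (fun i => RegenProduct.regenProcess (fun k => X k i) (fun k => T k i) (v i t) (φ ω)) = _
    rw [hω]
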